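/- Let $\mathbb D$ be the open unit disc and $\mathbb T$ the unit circle in $\mathbb C$, and let $\mu_1,\mu_2$ be finite positive Borel measures on $\overline{\mathbb D}$. For a finite positive Borel measure $\mu$ on $\overline{\mathbb D}$ put $$U_\mu(w)=\int_{\mathbb D}\log\left|\frac{1-\overline{\zeta}w}{w-\zeta}\right|^2\frac{d\mu(\zeta)}{1-|\zeta|^2}+\int_{\mathbb T}\frac{1-|w|^2}{|\zeta-w|^2}\,d\mu(\zeta),\qquad w\in\mathbb D,$$ where the logarithm is $+\infty$ at $\zeta=w$. For a holomorphic function $f$ on $\mathbb D^2$ let $$\mathcal D_{\mu_1,\mu_2}(f)=\sup_{0<r<1}\int_0^{2\pi}\!\int_{\mathbb D}|\partial_1 f(z_1,re^{i\theta})|^2U_{\mu_1}(z_1)\,dA(z_1)\frac{d\theta}{2\pi}+\sup_{0<r<1}\int_0^{2\pi}\!\int_{\mathbb D}|\partial_2 f(re^{i\theta},z_2)|^2U_{\mu_2}(z_2)\,dA(z_2)\frac{d\theta}{2\pi},$$ where $dA$ is the normalized area measure on $\mathbb D$. Let $H^2(\mathbb D^2)$ be the Hardy space of all holomorphic $f$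 on $\mathbb D^2$ with $\sup_{0<r<1}\int_0^{2\pi}\!\int_0^{2\pi}|f(re^{i\theta_1},re^{i\theta_2})|^2\frac{d\theta_2}{2\pi}\frac{d\theta_1}{2\pi}<\infty$, and let $\mathcal D(\mu_1,\mu_2)=\{f\in H^2(\mathbb D^2):\mathcal D_{\mu_1,\mu_2}(f)<\infty\}$. Then $\mathcal D(\mu_1,\mu_2)$ has the division property: for all $f\in\mathcal D(\mu_1,\mu_2)$ and $\lambda\in\mathbb D$, 1. if $f(\lambda,z_2)=0$ for every $z_2\in\mathbb D$, then there is $g\in\mathcal D(\mu_1,\mu_2)$ with $f(z_1,z_2)=(z_1-\lambda)g(z_1,z_2)$ on $\mathbb D^2$, that is, $f/(z_1-\lambda)$ (extended holomorphically across $z_1=\lambda$) belongs to $\mathcal D(\mu_1,\mu_2)$; 2. if $f(z_1,\lambda)=0$ for every $z_1\in\mathbb D$, then there is $g\in\mathcal D(\mu_1,\mu_2)$ with $f(z_1,z_2)=(z_2-\lambda)g(z_1,z_2)$ on $\mathbb D^2$, that is, $f/(z_2-\lambda)$ (extended likewise) belongs to $\mathcal D(\mu_1,\mu_2)$. -/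

import Mathlib

open MeasureTheory
open scoped ENNReal ComplexConjugate

noncomputable section

namespace DirichletBidisc

/-- The open unit disc in the complex plane. -/
def disc : Set ℂ := Metric.ball 0 1

/-- The closed unit disc, as a set; measures on the closed disc are measures on its subtype. -/
def closedDisc : Set ℂ := Metric.closedBall 0 1

/-- The open unit bidisc. -/
def bidisc : Set (ℂ × ℂ) := disc ×ˢ disc

/-- Normalized Lebesgue area measure on the open unit disc. -/
def areaMeasure : Measure ℂ := (ENNReal.ofReal Real.pi)⁻¹ • volume.restrict disc

/-- The measure `dθ / 2π` on `[0, 2π]`. -/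
def angleMeasure : Measure ℝ :=
  (ENNReal.ofReal (2 * Real.pi))⁻¹ • volume.restrict (Set.Icc 0 (2 * Real.pi))

/-- The point `r e^{iθ}`. -/
def polarPoint (r θ : ℝ) : ℂ := (r : ℂ) * Complex.exp ((θ : ℂ) * Complex.I)

/-- The kernel `log |(1 - conj ζ w) / (w - ζ)|² / (1 - |ζ|²)` for `ζ`, `w` in the open disc,
with its value `+∞` on the diagonal. -/
def greenKernel (ζ w : ℂ) : ℝ≥0∞ :=
  open Classical in
  if w = ζ then ⊤
  else ENNReal.ofReal (Real.log (‖(1 - conj ζ * w) / (w - ζ)‖ ^ 2) / (1 - ‖ζ‖ ^ 2))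

/-- The Poisson kernel `(1 - |w|²) / |ζ - w|²` for `ζ` on the circle and `w` in the disc. -/
def poissonKernel (ζ w : ℂ) : ℝ≥0∞ :=
  ENNReal.ofReal ((1 - ‖w‖ ^ 2) / ‖ζ - w‖ ^ 2)

/-- The positive superharmonic weight `U_μ` of a measure `μ` on the closed unit disc. -/
def weight (μ : Measure closedDisc) (w : ℂ) : ℝ≥0∞ :=
  (∫⁻ ζ in {ζ : closedDisc | ‖(ζ : ℂ)‖ < 1}, greenKernel ζ w ∂μ) +
    ∫⁻ ζ in {ζ : closedDisc | ‖(ζ : ℂ)‖ = 1}, poissonKernel ζ w ∂μ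

/-- The partial derivative `∂₁ f (z₁, z₂)`. -/
def partial₁ (f : ℂ × ℂ → ℂ) (z₁ z₂ : ℂ) : ℂ := deriv (fun w => f (w, z₂)) z₁

/-- The partial derivative `∂₂ f (z₁, z₂)`. -/
def partial₂ (f : ℂ × ℂ → ℂ) (z₁ z₂ : ℂ) : ℂ := deriv (fun w => f (z₁, w)) z₂

/-- The Dirichlet integral `D_{μ₁,μ₂}(f)`, with values in `[0, ∞]`. -/
def dirichletIntegral (μ₁ μ₂ : Measure closedDisc) (f : ℂ × ℂ → ℂ) : ℝ≥0∞ :=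
  (⨆ r ∈ Set.Ioo (0 : ℝ) 1, ∫⁻ θ, ∫⁻ z₁,
      ‖partial₁ f z₁ (polarPoint r θ)‖ₑ ^ 2 * weight μ₁ z₁ ∂areaMeasure ∂angleMeasure) +
    ⨆ r ∈ Set.Ioo (0 : ℝ) 1, ∫⁻ θ, ∫⁻ z₂,
      ‖partial₂ f (polarPoint r θ) z₂‖ₑ ^ 2 * weight μ₂ z₂ ∂areaMeasure ∂angleMeasure

/-- The square of the Hardy norm on the bidisc, with values in `[0, ∞]`. -/
def hardyNormSq (f : ℂ × ℂ → ℂ) : ℝ≥0∞ :=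
  ⨆ r ∈ Set.Ioo (0 : ℝ) 1, ∫⁻ θ₁, ∫⁻ θ₂,
    ‖f (polarPoint r θ₁, polarPoint r θ₂)‖ₑ ^ 2 ∂angleMeasure ∂angleMeasure

/-- The Hardy space `H²` of the bidisc. As usual, functions on the bidisc are represented by
functions on `ℂ × ℂ`, whose values off the bidisc play no role. -/
def hardySpace : Set (ℂ × ℂ → ℂ) :=
  {f | DifferentiableOn ℂ f bidisc ∧ hardyNormSq f < ⊤}

/-- The Dirichlet-type space `D(μ₁, μ₂)`. -/
def dirichletSpace (μ₁ μ₂ : Measure closedDisc) : Set (ℂ × ℂ → ℂ) :=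
  {f | f ∈ hardySpace ∧ dirichletIntegral μ₁ μ₂ f < ⊤}

/-- The division property of a space `H` of holomorphic functions on the bidisc: if `f ∈ H`
vanishes on the slice `{z_j = a}`, then `f / (z_j - a)` (extended across the slice) is in `H`,
for `j = 1, 2`. -/
def HasDivisionProperty (H : Set (ℂ × ℂ → ℂ)) : Prop :=
  (∀ f ∈ H, ∀ a ∈ disc, (∀ z₂ ∈ disc, f (a, z₂) = 0) →
    ∃ g ∈ H, ∀ z ∈ bidisc, f z = (z.1 - a) * g z) ∧
  (∀ f ∈ H, ∀ a ∈ disc, (∀ z₁ ∈ disc, f (z₁, a) = 0) →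
    ∃ g ∈ H, ∀ z ∈ bidisc, f z = (z.2 - a) * g z)

end DirichletBidisc

end

open MeasureTheory
open scoped ENNReal ComplexConjugate

noncomputable section

namespace DirichletBidisc

open Filter Topology

/-! By the symmetry of the two variables it suffices to divide by `z₁ - a`. Write `f = (z₁ - a) g`.
Near the torus the factor `z₁ - a` is bounded below, and near `z₁ = a` holomorphy controls `g`; the
point is to make both remarks quantitative.

The Hardy norm of `g` and the `∂₂` part of its Dirichlet integral are suprema of quantities that
increase with the radius of the circle in `z₁`, because the circle means of `|h|²` increase for
holomorphic `h` (`circleMean_mono`). So this circle may be pushed outside `|z₁| = (1 + |a|)/2`,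
where `|z₁ - a|` is bounded below. Since `∂₂ f = (z₁ - a) ∂₂ g`, both quantities are bounded by
those of `f` (`slicedDirichlet₂_mono` gives the monotonicity of the `∂₂` part).

For the `∂₁` part, `∂₁ f = g + (z₁ - a) ∂₁ g`, so `g` itself has to be controlled against the
weight. This is the Carleson embedding `lintegral_enorm_sq_mul_weight_le`: `∫ |h|² U_μ dA ≤ 8
μ(closed disc) ‖h‖²` in the Hardy space of the disc. It holds because the mean of `U_μ` over `|w| =
r` is at most `μ(closed disc) / r`, while `|h(z)|` has the radial majorant `∑ |aₙ| |z|ⁿ`, whose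
square is integrable on `(0, 1)` by Hardy's inequality. The resulting one-variable bound
`exists_division_bound` has a constant depending only on `a`, so it can be integrated over the
slices. -/

/-- The mean of `‖h‖²` over the circle of radius `r`. -/
def circleMean (h : ℂ → ℂ) (r : ℝ) : ℝ≥0∞ :=
  ∫⁻ θ, ‖h (polarPoint r θ)‖ₑ ^ 2 ∂angleMeasure

/-! ### Circles and the normalized angle measure. -/

theorem polarPoint_eq_circleMap (r θ : ℝ) : polarPoint r θ = circleMap 0 r θ := by
  simp [polarPoint, circleMap]

@[simp]
theorem norm_polarPoint (r θ : ℝ) : ‖polarPoint r θ‖ = |r| := by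
  simp [polarPoint_eq_circleMap]

theorem continuous_polarPoint (r : ℝ) : Continuous (polarPoint r) := by
  unfold polarPoint; fun_prop

theorem mem_disc {z : ℂ} : z ∈ disc ↔ ‖z‖ < 1 := by simp [disc]

theorem isOpen_disc : IsOpen disc := Metric.isOpen_ball

theorem isOpen_bidisc : IsOpen bidisc := isOpen_disc.prod isOpen_disc

theorem polarPoint_mem_disc {r : ℝ} (h0 : 0 ≤ r) (h1 : r < 1) (θ : ℝ) : polarPoint r θ ∈ disc := by
  rw [mem_disc, norm_polarPoint, abs_of_nonneg h0]; exact h1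

instance : IsProbabilityMeasure angleMeasure := by
  constructor
  have h : (0 : ℝ) < 2 * Real.pi := by positivity
  simp only [angleMeasure, Measure.smul_apply, Measure.restrict_apply MeasurableSet.univ,
    Set.univ_inter, Real.volume_Icc, sub_zero, smul_eq_mul]
  exact ENNReal.inv_mul_cancel (by simpa using h) ENNReal.ofReal_ne_top

theorem lintegral_angleMeasure (F : ℝ → ℝ≥0∞) :
    ∫⁻ θ, F θ ∂angleMeasure =
      (ENNReal.ofReal (2 * Real.pi))⁻¹ * ∫⁻ θ in Set.Ioc 0 (2 * Real.pi), F θ := by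
  rw [angleMeasure, lintegral_smul_measure, smul_eq_mul, restrict_Ioc_eq_restrict_Icc]

theorem lintegral_angleMeasure_ofReal {F : ℂ → ℝ} {r : ℝ} (hF : CircleIntegrable F 0 r)
    (h0 : ∀ θ, 0 ≤ F (polarPoint r θ)) :
    ∫⁻ θ, ENNReal.ofReal (F (polarPoint r θ)) ∂angleMeasure =
      ENNReal.ofReal (Real.circleAverage F 0 r) := by
  have hpi : (0 : ℝ) < 2 * Real.pi := by positivity
  have hI : IntegrableOn (fun θ => F (polarPoint r θ)) (Set.Ioc 0 (2 * Real.pi)) := by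
    simp only [polarPoint_eq_circleMap]
    exact (intervalIntegrable_iff_integrableOn_Ioc_of_le hpi.le).1 hF
  rw [lintegral_angleMeasure, ← ofReal_integral_eq_lintegral_ofReal hI
    (Eventually.of_forall h0), Real.circleAverage_def, smul_eq_mul,
    ENNReal.ofReal_mul (inv_nonneg.2 hpi.le), ENNReal.ofReal_inv_of_pos hpi,
    intervalIntegral.integral_of_le hpi.le]
  simp only [polarPoint_eq_circleMap]

/-! ### Taylor coefficients and Parseval's identity. -/

/-- The Taylor coefficients at the origin. -/
def taylorCoeff (h : ℂ → ℂ) (n : ℕ) : ℂ := (n.factorial : ℂ)⁻¹ * iteratedDeriv n h 0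

theorem hasSum_taylorCoeff {h : ℂ → ℂ} (hh : DifferentiableOn ℂ h disc) {z : ℂ} (hz : z ∈ disc) :
    HasSum (fun n => taylorCoeff h n * z ^ n) (h z) := by
  have := Complex.hasSum_taylorSeries_on_ball (f := h) (c := 0) (r := 1) (by simpa [disc] using hh)
    (z := z) (by simpa [disc] using hz)
  have heq : (fun n => taylorCoeff h n * z ^ n) =
      fun n : ℕ => (n.factorial : ℂ)⁻¹ • (z - 0) ^ n • iteratedDeriv n h 0 := by
    funext n
    simp only [taylorCoeff, sub_zero, smul_eq_mul]
    ring
  rw [heq]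
  exact this

theorem summable_norm_taylorCoeff {h : ℂ → ℂ} (hh : DifferentiableOn ℂ h disc) {r : ℝ}
    (h0 : 0 ≤ r) (h1 : r < 1) : Summable fun n => ‖taylorCoeff h n‖ * r ^ n := by
  obtain ⟨s, hrs, hs1⟩ := exists_between h1
  have hs0 : 0 < s := h0.trans_lt hrs
  have hsum := (hasSum_taylorCoeff hh (z := (s : ℂ))
    (by rw [mem_disc]; simpa [abs_of_pos hs0] using hs1)).summable
  obtain ⟨C, hC⟩ := hsum.tendsto_atTop_zero.norm.bddAbove_range
  have hC' : ∀ n, ‖taylorCoeff h n‖ * s ^ n ≤ C := fun n => by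
    have := hC ⟨n, rfl⟩
    simpa [abs_of_pos hs0] using this
  refine Summable.of_nonneg_of_le (fun n => by positivity) (fun n => ?_)
    ((summable_geometric_of_lt_one (r := r / s) (by positivity)
      ((div_lt_one hs0).2 hrs)).mul_left C)
  calc ‖taylorCoeff h n‖ * r ^ n = (‖taylorCoeff h n‖ * s ^ n) * (r / s) ^ n := by
        rw [div_pow]; field_simp
    _ ≤ C * (r / s) ^ n := by gcongr; exact hC' n

theorem circleMean_sum_range (a : ℕ → ℂ) (N : ℕ) (r : ℝ) :
    circleMean (fun z => ∑ n ∈ Finset.range N, a n * z ^ n) r =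
      ∑ n ∈ Finset.range N, ‖a n‖ₑ ^ 2 * ENNReal.ofReal (r ^ (2 * n)) := by
  classical
  -- The radius is absorbed into the coefficients, which reduces the claim to Parseval for
  -- polynomials on the unit circle.
  set p : Polynomial ℂ := ∑ n ∈ Finset.range N, Polynomial.monomial n (a n * (r : ℂ) ^ n) with hp
  have hcoeff : ∀ i, p.coeff i = if i ∈ Finset.range N then a i * (r : ℂ) ^ i else 0 := fun i => by
    simp only [hp, Polynomial.finsetSum_coeff, Polynomial.coeff_monomial]
    rw [Finset.sum_ite_eq' (Finset.range N) i]
  have heval : ∀ θ, p.eval (circleMap 0 1 θ) =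
      ∑ n ∈ Finset.range N, a n * (polarPoint r θ) ^ n := fun θ => by
    simp only [hp, Polynomial.eval_finsetSum, Polynomial.eval_monomial]
    refine Finset.sum_congr rfl fun n _ => ?_
    simp [polarPoint, circleMap, mul_pow, mul_assoc]
  have key := p.sum_sq_norm_coeff_eq_circleAverage
  have hsum : ∑ i ∈ p.support, ‖p.coeff i‖ ^ 2 =
      ∑ n ∈ Finset.range N, ‖a n‖ ^ 2 * r ^ (2 * n) := by
    have hsub : p.support ⊆ Finset.range N := fun i hi => by
      by_contra hni
      simp [hcoeff, hni] at hi
    rw [Finset.sum_subset hsub fun i _ hi => by simp [Polynomial.notMem_support_iff.1 hi]]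
    refine Finset.sum_congr rfl fun n hn => ?_
    rw [hcoeff, if_pos hn, norm_mul, mul_pow, norm_pow, Complex.norm_real, Real.norm_eq_abs,
      ← pow_mul, mul_comm n 2, pow_mul, sq_abs, ← pow_mul]
  have hint := lintegral_angleMeasure_ofReal (F := fun z => ‖p.eval z‖ ^ 2) (r := 1)
    (ContinuousOn.circleIntegrable (by norm_num) (by fun_prop)) (fun _ => by positivity)
  rw [← key, hsum, ENNReal.ofReal_sum_of_nonneg] at hint
  · unfold circleMean
    calc _ = ∫⁻ θ, ENNReal.ofReal (‖p.eval (polarPoint 1 θ)‖ ^ 2) ∂angleMeasure := by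
          refine lintegral_congr fun θ => ?_
          rw [polarPoint_eq_circleMap 1, heval, ENNReal.ofReal_pow (norm_nonneg _), ofReal_norm]
      _ = _ := by
          rw [hint]
          refine Finset.sum_congr rfl fun n _ => ?_
          rw [ENNReal.ofReal_mul (by positivity), ENNReal.ofReal_pow (norm_nonneg _), ofReal_norm]
  · intro n _
    have : 0 ≤ r ^ (2 * n) := by rw [pow_mul]; positivity
    positivity

/-- **Parseval's identity** on circles centred at the origin. -/
theorem circleMean_eq_tsum {h : ℂ → ℂ} (hh : DifferentiableOn ℂ h disc) {r : ℝ}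
    (h0 : 0 ≤ r) (h1 : r < 1) :
    circleMean h r = ∑' n, ‖taylorCoeff h n‖ₑ ^ 2 * ENNReal.ofReal (r ^ (2 * n)) := by
  set a := taylorCoeff h
  have hs := summable_norm_taylorCoeff hh h0 h1
  have hA : 0 ≤ ∑' n, ‖a n‖ * r ^ n := tsum_nonneg fun n => by positivity
  have hlim : Tendsto (fun N => circleMean (fun z => ∑ n ∈ Finset.range N, a n * z ^ n) r) atTop
      (𝓝 (circleMean h r)) := by
    refine tendsto_lintegral_of_dominated_convergence
      (fun _ => ENNReal.ofReal (∑' n, ‖a n‖ * r ^ n) ^ 2) (fun N => ?_) (fun N => ?_) ?_ ?_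
    · have := continuous_polarPoint r
      fun_prop
    · refine Eventually.of_forall fun θ => ?_
      dsimp only
      gcongr
      rw [← ofReal_norm]
      refine ENNReal.ofReal_le_ofReal ((norm_sum_le _ _).trans ?_)
      refine le_trans (le_of_eq ?_) (hs.sum_le_tsum (Finset.range N) fun n _ => by positivity)
      simp [abs_of_nonneg h0]
    · simp
    · refine Eventually.of_forall fun θ => ?_
      have := (hasSum_taylorCoeff hh (polarPoint_mem_disc h0 h1 θ)).tendsto_sum_nat
      exact ((ENNReal.continuous_pow 2).comp continuous_enorm).continuousAt.tendsto.comp this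
  simp only [circleMean_sum_range] at hlim
  exact tendsto_nhds_unique hlim ENNReal.summable.hasSum.tendsto_sum_nat

/-- Each term of Parseval's series increases with the radius. This is what later allows circles to
be moved away from the zero set of the divisor. -/
theorem circleMean_mono {h : ℂ → ℂ} (hh : DifferentiableOn ℂ h disc) {r s : ℝ}
    (h0 : 0 ≤ r) (hrs : r ≤ s) (h1 : s < 1) : circleMean h r ≤ circleMean h s := by
  rw [circleMean_eq_tsum hh h0 (hrs.trans_lt h1), circleMean_eq_tsum hh (h0.trans hrs) h1]
  gcongr

theorem tsum_sq_taylorCoeff_le {h : ℂ → ℂ} (hh : DifferentiableOn ℂ h disc) :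
    ∑' n, ‖taylorCoeff h n‖ₑ ^ 2 ≤ ⨆ r ∈ Set.Ioo (0 : ℝ) 1, circleMean h r := by
  refine ENNReal.tsum_le_of_sum_range_le fun N => ?_
  have hlim : Tendsto (fun r : ℝ => ∑ n ∈ Finset.range N,
      ‖taylorCoeff h n‖ₑ ^ 2 * ENNReal.ofReal (r ^ (2 * n))) (𝓝[<] 1)
      (𝓝 (∑ n ∈ Finset.range N, ‖taylorCoeff h n‖ₑ ^ 2 * ENNReal.ofReal (1 ^ (2 * n)))) := by
    refine tendsto_finsetSum _ fun n _ => ENNReal.Tendsto.const_mul ?_ (Or.inr (by simp))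
    refine (ENNReal.continuous_ofReal.tendsto _).comp ?_
    exact ((continuous_pow (2 * n)).tendsto 1).mono_left nhdsWithin_le_nhds
  simp only [one_pow, ENNReal.ofReal_one, mul_one] at hlim
  refine le_of_tendsto hlim ?_
  filter_upwards [Ioo_mem_nhdsLT (show (0 : ℝ) < 1 by norm_num)] with r hr
  refine le_trans ?_ (le_iSup₂ (f := fun r (_ : r ∈ Set.Ioo (0 : ℝ) 1) => circleMean h r) r hr)
  rw [circleMean_eq_tsum hh hr.1.le hr.2]
  exact ENNReal.sum_le_tsum _

theorem enorm_le_tsum {h : ℂ → ℂ} (hh : DifferentiableOn ℂ h disc) {z : ℂ} (hz : z ∈ disc) :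
    ‖h z‖ₑ ≤ ∑' n, ‖taylorCoeff h n‖ₑ * ‖z‖ₑ ^ n := by
  rw [← (hasSum_taylorCoeff hh hz).tsum_eq]
  refine (enorm_tsum_le_tsum_enorm).trans (le_of_eq ?_)
  simp [enorm_mul, enorm_pow]

/-! ### Hardy's inequality and radial integrals of power series. -/

/-- **Hardy's inequality** for the averages of a finite sequence. -/
theorem sum_mul_average_le (b : ℕ → ℝ) (N : ℕ) :
    ∑ n ∈ Finset.range N, b n * ((∑ m ∈ Finset.range (n + 1), b m) / (n + 1)) ≤
      2 * ∑ n ∈ Finset.range N, b n ^ 2 := by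
  set A : ℕ → ℝ := fun n => (∑ m ∈ Finset.range (n + 1), b m) / (n + 1) with hA
  -- With `b n = (n + 1) A n - n A (n - 1)`, the inequality `2 A n A (n - 1) ≤ A n ² + A (n - 1)²`
  -- bounds the `n`-th term by `n A (n - 1)² - (n + 1) A n ²`, which telescopes. The value `0`
  -- stands for `A (-1)`.
  have htel : ∀ N : ℕ, ∑ n ∈ Finset.range N, (A n ^ 2 - 2 * (b n * A n)) ≤
      -((N : ℝ) * (if N = 0 then 0 else A (N - 1)) ^ 2) := by
    intro N
    induction N with
    | zero => simp
    | succ N ih =>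
      rw [Finset.sum_range_succ]
      have hb : b N = (N + 1) * A N - N * (if N = 0 then 0 else A (N - 1)) := by
        rcases Nat.eq_zero_or_pos N with rfl | hN
        · simp [hA]
        · have h1 : N - 1 + 1 = N := Nat.sub_add_cancel hN
          have h2 : ((N - 1 : ℕ) : ℝ) + 1 = N := by exact_mod_cast h1
          have h3 : (N : ℝ) ≠ 0 := by positivity
          have h4 : (N : ℝ) + 1 ≠ 0 := by positivity
          simp only [hA, if_neg hN.ne', h1, h2]
          rw [mul_div_cancel₀ _ h4, mul_div_cancel₀ _ h3, Finset.sum_range_succ]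
          ring
      set B : ℝ := if N = 0 then 0 else A (N - 1)
      simp only [Nat.add_sub_cancel, Nat.succ_ne_zero, if_false]
      push_cast
      rw [hb]
      nlinarith [mul_nonneg (Nat.cast_nonneg (α := ℝ) N) (sq_nonneg (A N - B))]
  have h1 : ∑ n ∈ Finset.range N, (A n ^ 2 - 2 * (b n * A n)) ≤ 0 :=
    (htel N).trans (neg_nonpos.2 (by positivity))
  -- From `∑ A² ≤ 2 ∑ b A` and `2 b A ≤ A² / 2 + 2 b²`, the sum of `A²` is eliminated, leaving `∑ b
  -- A ≤ 2 ∑ b²`.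
  have h2 : ∑ n ∈ Finset.range N, (2 * (b n * A n)) ≤
      ∑ n ∈ Finset.range N, (A n ^ 2 / 2 + 2 * b n ^ 2) :=
    Finset.sum_le_sum fun n _ => by nlinarith [sq_nonneg (A n - 2 * b n)]
  simp only [Finset.sum_sub_distrib, Finset.sum_add_distrib, ← Finset.mul_sum,
    ← Finset.sum_div] at h1 h2
  linarith

/-- A form of Hilbert's inequality: the integral is `∑ b m b n / (m + n + 1)`. Replacing `m + n + 1`
by `max m n + 1` turns the double sum into products of `b n` with the averages in Hardy's
inequality; the diagonal is counted twice, which only enlarges the bound. -/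
theorem integral_sq_sum_le (b : ℕ → ℝ) (hb : ∀ n, 0 ≤ b n) (N : ℕ) :
    ∫ r in (0 : ℝ)..1, (∑ n ∈ Finset.range N, b n * r ^ n) ^ 2 ≤
      4 * ∑ n ∈ Finset.range N, b n ^ 2 := by
  have key : ∫ r in (0 : ℝ)..1, (∑ n ∈ Finset.range N, b n * r ^ n) ^ 2 ≤
      ∑ n ∈ Finset.range N, 2 * (b n * ((∑ m ∈ Finset.range (n + 1), b m) / (n + 1))) := by
    induction N with
    | zero => simp
    | succ N ih =>
      have hexp : ∀ r : ℝ, (∑ n ∈ Finset.range (N + 1), b n * r ^ n) ^ 2 =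
          (∑ n ∈ Finset.range N, b n * r ^ n) ^ 2 +
            (∑ n ∈ Finset.range N, (2 * b N * b n) * r ^ (n + N) + b N ^ 2 * r ^ (2 * N)) := by
        intro r
        rw [Finset.sum_range_succ]
        have : ∑ n ∈ Finset.range N, (2 * b N * b n) * r ^ (n + N) =
            2 * (b N * r ^ N) * ∑ n ∈ Finset.range N, b n * r ^ n := by
          rw [Finset.mul_sum]
          exact Finset.sum_congr rfl fun n _ => by ring
        rw [this]
        ring
      simp only [hexp]
      rw [intervalIntegral.integral_add (Continuous.intervalIntegrable (by fun_prop) _ _)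
        (Continuous.intervalIntegrable (by fun_prop) _ _), Finset.sum_range_succ]
      refine add_le_add ih ?_
      rw [intervalIntegral.integral_add (Continuous.intervalIntegrable (by fun_prop) _ _)
        (Continuous.intervalIntegrable (by fun_prop) _ _), intervalIntegral.integral_finsetSum
        fun n _ => Continuous.intervalIntegrable (by fun_prop) _ _]
      simp only [intervalIntegral.integral_const_mul, integral_pow]
      rw [Finset.sum_range_succ, add_div, mul_add, mul_add, Finset.sum_div, Finset.mul_sum,
        Finset.mul_sum]
      refine add_le_add (Finset.sum_le_sum fun n _ => ?_) ?_
      · have := mul_nonneg (hb N) (hb n)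
        have h2 : (1 : ℝ) / (n + N + 1) ≤ 1 / (N + 1) := by
          gcongr; linarith [Nat.cast_nonneg (α := ℝ) n]
        calc _ = 2 * (b N * b n) * (1 / (n + N + 1)) := by push_cast; rw [one_pow, zero_pow (by omega)]; ring
          _ ≤ 2 * (b N * b n) * (1 / (N + 1)) := by gcongr
          _ = _ := by ring
      · have h2 : (1 : ℝ) / (2 * N + 1) ≤ 1 / (N + 1) := by
          gcongr; linarith [Nat.cast_nonneg (α := ℝ) N]
        calc _ = b N ^ 2 * (1 / (2 * N + 1)) := by simp
          _ ≤ b N ^ 2 * (1 / (N + 1)) := by gcongr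
          _ ≤ 2 * (b N ^ 2 * (1 / (N + 1))) := by
            have : 0 ≤ b N ^ 2 * (1 / ((N : ℝ) + 1)) := by positivity
            linarith
          _ = _ := by ring
  refine key.trans ?_
  rw [← Finset.mul_sum]
  linarith [sum_mul_average_le b N]

theorem lintegral_sq_tsum_le (b : ℕ → ℝ≥0∞) (hb : ∀ n, b n ≠ ⊤) :
    ∫⁻ r in Set.Ioo (0 : ℝ) 1, (∑' n, b n * ENNReal.ofReal r ^ n) ^ 2 ≤ 4 * ∑' n, b n ^ 2 := by
  have hmono : Monotone fun (N : ℕ) (r : ℝ) =>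
      (∑ n ∈ Finset.range N, b n * ENNReal.ofReal r ^ n) ^ 2 := fun N M h r => by
    dsimp only
    gcongr
  have hsup : ∀ r : ℝ, (∑' n, b n * ENNReal.ofReal r ^ n) ^ 2 =
      ⨆ N : ℕ, (∑ n ∈ Finset.range N, b n * ENNReal.ofReal r ^ n) ^ 2 := fun r =>
    tendsto_nhds_unique
      (((ENNReal.continuous_pow 2).tendsto _).comp ENNReal.summable.hasSum.tendsto_sum_nat)
      (tendsto_atTop_iSup fun N M h => hmono h r)
  simp only [hsup]
  rw [lintegral_iSup (fun N => by fun_prop) hmono]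
  refine iSup_le fun N => le_trans ?_ (mul_le_mul_right (ENNReal.sum_le_tsum (Finset.range N)) 4)
  set c : ℕ → ℝ := fun n => (b n).toReal
  have hbc : ∀ n, b n = ENNReal.ofReal (c n) := fun n => (ENNReal.ofReal_toReal (hb n)).symm
  have hc : ∀ n, 0 ≤ c n := fun n => ENNReal.toReal_nonneg
  have hcont : Continuous fun r : ℝ => (∑ n ∈ Finset.range N, c n * r ^ n) ^ 2 := by fun_prop
  calc ∫⁻ r in Set.Ioo (0 : ℝ) 1, (∑ n ∈ Finset.range N, b n * ENNReal.ofReal r ^ n) ^ 2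
      = ∫⁻ r in Set.Ioc (0 : ℝ) 1,
          ENNReal.ofReal ((∑ n ∈ Finset.range N, c n * r ^ n) ^ 2) := by
        rw [restrict_Ioo_eq_restrict_Ioc]
        refine setLIntegral_congr_fun measurableSet_Ioc fun r hr => ?_
        have hr0 := hr.1.le
        rw [ENNReal.ofReal_pow (Finset.sum_nonneg fun n _ => mul_nonneg (hc n) (by positivity)),
          ENNReal.ofReal_sum_of_nonneg fun n _ => mul_nonneg (hc n) (by positivity)]
        congr 1
        refine Finset.sum_congr rfl fun n _ => ?_
        rw [ENNReal.ofReal_mul (hc n), ENNReal.ofReal_pow hr0, hbc]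
    _ = ENNReal.ofReal (∫ r in (0 : ℝ)..1, (∑ n ∈ Finset.range N, c n * r ^ n) ^ 2) := by
        rw [intervalIntegral.integral_of_le zero_le_one, ofReal_integral_eq_lintegral_ofReal
          ((intervalIntegrable_iff_integrableOn_Ioc_of_le zero_le_one).1
            (hcont.intervalIntegrable 0 1)) (Eventually.of_forall fun _ => by positivity)]
    _ ≤ ENNReal.ofReal (4 * ∑ n ∈ Finset.range N, c n ^ 2) :=
        ENNReal.ofReal_le_ofReal (integral_sq_sum_le c hc N)
    _ = 4 * ∑ n ∈ Finset.range N, b n ^ 2 := by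
        rw [ENNReal.ofReal_mul (by norm_num), ENNReal.ofReal_sum_of_nonneg fun n _ => by positivity]
        simp [hbc, ENNReal.ofReal_pow, hc]

/-! ### Polar coordinates and circle means of the weight. -/

/-- The area integral in polar coordinates. -/
theorem lintegral_areaMeasure {F : ℂ → ℝ≥0∞} (hF : Measurable F) :
    ∫⁻ z, F z ∂areaMeasure = ∫⁻ r in Set.Ioo (0 : ℝ) 1,
      ENNReal.ofReal (2 * r) * ∫⁻ θ, F (polarPoint r θ) ∂angleMeasure := by
  have hpi := Real.pi_pos
  set G : ℂ → ℝ≥0∞ := disc.indicator F with hG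
  have hGm : Measurable G := hF.indicator isOpen_disc.measurableSet
  -- Polar coordinates have angles in `(-π, π)`, `angleMeasure` lives on `[0, 2π]`. The reflection
  -- `z ↦ -z` shifts the angle by `π` and matches the two.
  have h1 : ∫⁻ z, F z ∂areaMeasure = (ENNReal.ofReal Real.pi)⁻¹ * ∫⁻ z, G (-z) := by
    rw [areaMeasure, lintegral_smul_measure, smul_eq_mul, hG,
      (Measure.measurePreserving_neg (volume : Measure ℂ)).lintegral_comp hGm,
      lintegral_indicator isOpen_disc.measurableSet]
  have hshift : ∀ r : ℝ, ∫⁻ θ in Set.Ioo (-Real.pi) Real.pi,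
      G (-(Complex.polarCoord.symm (r, θ))) =
        ENNReal.ofReal (2 * Real.pi) * ∫⁻ θ, G (polarPoint r θ) ∂angleMeasure := by
    intro r
    have hpt : ∀ θ : ℝ, G (-(Complex.polarCoord.symm (r, θ))) = G (polarPoint r (θ + Real.pi)) := by
      intro θ
      congr 1
      rw [Complex.polarCoord_symm_apply, polarPoint]
      push_cast
      rw [add_mul, Complex.exp_add, Complex.exp_pi_mul_I, Complex.exp_mul_I]
      ring
    simp only [hpt]
    have hmp := (measurePreserving_add_right (volume : Measure ℝ) Real.pi).restrict_preimage
      (s := Set.Ioo 0 (2 * Real.pi)) measurableSet_Ioo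
    have hpre : (fun x => x + Real.pi) ⁻¹' Set.Ioo 0 (2 * Real.pi) =
        Set.Ioo (-Real.pi) Real.pi := by
      rw [Set.preimage_add_const_Ioo]; congr 1 <;> ring
    rw [hpre] at hmp
    rw [hmp.lintegral_comp (f := fun θ => G (polarPoint r θ))
      (hGm.comp (continuous_polarPoint r).measurable), lintegral_angleMeasure,
      ← mul_assoc, ENNReal.mul_inv_cancel (by simpa using hpi) ENNReal.ofReal_ne_top, one_mul,
      restrict_Ioo_eq_restrict_Ioc]
  have hmeas : Measurable fun p : ℝ × ℝ =>
      ENNReal.ofReal p.1 • G (-(Complex.polarCoord.symm p)) := by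
    have : Measurable fun p : ℝ × ℝ => Complex.polarCoord.symm p := by
      simp only [Complex.polarCoord_symm_apply]; fun_prop
    have := hGm.comp this.neg
    simp only [smul_eq_mul]
    exact (ENNReal.measurable_ofReal.comp measurable_fst).mul this
  rw [h1, ← Complex.lintegral_comp_polarCoord_symm, polarCoord_target, Measure.volume_eq_prod,
    setLIntegral_prod _ hmeas.aemeasurable]
  simp only [smul_eq_mul]
  have h2 : ∀ r : ℝ, ∫⁻ θ in Set.Ioo (-Real.pi) Real.pi,
      ENNReal.ofReal r * G (-(Complex.polarCoord.symm (r, θ))) =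
        ENNReal.ofReal Real.pi * (ENNReal.ofReal (2 * r) *
          ∫⁻ θ, G (polarPoint r θ) ∂angleMeasure) := by
    intro r
    rw [lintegral_const_mul' _ _ ENNReal.ofReal_ne_top, hshift, ENNReal.ofReal_mul zero_le_two,
      ENNReal.ofReal_mul zero_le_two]
    ring
  simp only [h2]
  rw [lintegral_const_mul' _ _ ENNReal.ofReal_ne_top, ← mul_assoc,
    ENNReal.inv_mul_cancel (by simpa using hpi) ENNReal.ofReal_ne_top, one_mul]
  rw [← Set.Ioo_union_Ici_eq_Ioi (show (0 : ℝ) < 1 by norm_num),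
    lintegral_union measurableSet_Ici (Set.disjoint_left.2 fun x hx hx' => not_le.2 hx.2 hx')]
  have h3 : ∫⁻ r in Set.Ici (1 : ℝ), ENNReal.ofReal (2 * r) *
      ∫⁻ θ, G (polarPoint r θ) ∂angleMeasure = 0 := by
    rw [setLIntegral_congr_fun (g := fun _ => 0) measurableSet_Ici]
    · simp
    · intro r hr
      have : ∀ θ, G (polarPoint r θ) = 0 := fun θ => Set.indicator_of_notMem (by
        rw [mem_disc, norm_polarPoint, not_lt]; exact hr.out.trans (le_abs_self r)) _
      simp [this]
  rw [h3, add_zero]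
  refine setLIntegral_congr_fun measurableSet_Ioo fun r hr => ?_
  have : ∀ θ, G (polarPoint r θ) = F (polarPoint r θ) := fun θ =>
    Set.indicator_of_mem (polarPoint_mem_disc hr.1.le hr.2 θ) _
  simp [this]

theorem measurable_greenKernel : Measurable fun p : ℂ × ℂ => greenKernel p.1 p.2 := by
  unfold greenKernel
  refine Measurable.ite (measurableSet_eq_fun measurable_snd measurable_fst) measurable_const ?_
  fun_prop

theorem measurable_poissonKernel : Measurable fun p : ℂ × ℂ => poissonKernel p.1 p.2 := by
  unfold poissonKernel
  fun_prop

theorem measurable_weight (μ : Measure closedDisc) [IsFiniteMeasure μ] : Measurable (weight μ) := by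
  unfold weight
  refine Measurable.add ?_ ?_
  · exact Measurable.lintegral_prod_left' (f := fun p : closedDisc × ℂ => greenKernel p.1 p.2)
      (measurable_greenKernel.comp (f := fun p : closedDisc × ℂ => ((p.1 : ℂ), p.2)) (by fun_prop))
  · exact Measurable.lintegral_prod_left' (f := fun p : closedDisc × ℂ => poissonKernel p.1 p.2)
      (measurable_poissonKernel.comp (f := fun p : closedDisc × ℂ => ((p.1 : ℂ), p.2)) (by fun_prop))

theorem one_sub_conj_mul_ne_zero {ζ w : ℂ} (hζ : ‖ζ‖ ≤ 1) (hw : ‖w‖ < 1) :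
    1 - conj ζ * w ≠ 0 := by
  intro h
  have h1 : ‖conj ζ * w‖ = 1 := by rw [← sub_eq_zero.1 h, norm_one]
  rw [norm_mul, RCLike.norm_conj] at h1
  nlinarith [norm_nonneg ζ, norm_nonneg w]

theorem ae_polarPoint_ne {r : ℝ} (hr : r ≠ 0) (ζ : ℂ) : ∀ᵐ θ : ℝ, polarPoint r θ ≠ ζ := by
  have := ((Set.countable_singleton ζ).preimage_circleMap 0 hr).ae_notMem volume
  filter_upwards [this] with θ hθ h
  exact hθ (by rw [Set.mem_preimage, ← polarPoint_eq_circleMap]; exact h)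

theorem ae_angleMeasure_of_ae {p : ℝ → Prop} (h : ∀ᵐ θ : ℝ, p θ) : ∀ᵐ θ ∂angleMeasure, p θ :=
  Measure.ae_smul_measure (ae_restrict_of_ae h) _

theorem circleAverage_congr_of_ne {F G : ℂ → ℝ} {r : ℝ} (hr : 0 < r) (ζ : ℂ)
    (h : ∀ w, ‖w‖ = r → w ≠ ζ → F w = G w) :
    Real.circleAverage F 0 r = Real.circleAverage G 0 r := by
  rw [Real.circleAverage_def, Real.circleAverage_def]
  congr 1
  refine intervalIntegral.integral_congr_ae ?_
  filter_upwards [ae_polarPoint_ne hr.ne' ζ] with θ hθ _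
  rw [polarPoint_eq_circleMap] at hθ
  exact h _ (by simp [abs_of_pos hr]) hθ

theorem circleAverage_log_norm_one_sub {ζ : ℂ} (hζ : ‖ζ‖ ≤ 1) {r : ℝ} (h0 : 0 < r) (h1 : r < 1) :
    Real.circleAverage (fun w => Real.log ‖1 - conj ζ * w‖) 0 r = 0 := by
  have hh : InnerProductSpace.HarmonicOnNhd (fun w => Real.log ‖1 - conj ζ * w‖)
      (Metric.closedBall 0 |r|) := fun w hw => by
    refine AnalyticAt.harmonicAt_log_norm (f := fun w => 1 - conj ζ * w) (by fun_prop)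
      (one_sub_conj_mul_ne_zero hζ ?_)
    rw [mem_closedBall_zero_iff, abs_of_pos h0] at hw
    exact hw.trans_lt h1
  rw [hh.circleAverage_eq]
  simp

theorem circleAverage_log_norm_sub {ζ : ℂ} {r : ℝ} (h0 : 0 < r) :
    Real.circleAverage (fun w => Real.log ‖w - ζ‖) 0 r = Real.log (max r ‖ζ‖) := by
  have h := circleAverage_log_norm_sub_const_eq_log_radius_add_posLog (a := ζ) (c := 0) h0.ne'
  rw [h, zero_sub, norm_neg]
  rcases le_total r ‖ζ‖ with hle | hle
  · have h2 : 1 ≤ r⁻¹ * ‖ζ‖ := by rw [← div_eq_inv_mul, one_le_div h0]; exact hle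
    have h3 : 0 < ‖ζ‖ := h0.trans_le hle
    rw [max_eq_right hle, Real.posLog_eq_log (by rwa [abs_of_pos (by positivity)]),
      Real.log_mul (by positivity) (by positivity), Real.log_inv]
    ring
  · have h2 : r⁻¹ * ‖ζ‖ ≤ 1 := by rw [← div_eq_inv_mul, div_le_one h0]; exact hle
    rw [max_eq_left hle, (Real.posLog_eq_zero_iff _).2 (by rwa [abs_of_nonneg (by positivity)]),
      add_zero]

/-- This is `x ≤ sinh x` at `x = -log t`. The factor `1 - t²` is what cancels the denominator `1 -
|ζ|²` of the Green kernel. -/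
theorem neg_two_mul_log_le {t : ℝ} (h0 : 0 < t) (h1 : t ≤ 1) :
    -(2 * Real.log t) ≤ (1 - t ^ 2) / t := by
  have h := Real.self_le_sinh_iff.2 (show 0 ≤ -Real.log t by linarith [Real.log_nonpos h0.le h1])
  rw [Real.sinh_eq, neg_neg, Real.exp_neg, Real.exp_log h0] at h
  have : (1 - t ^ 2) / t = t⁻¹ - t := by field_simp
  rw [this]
  linarith

theorem one_le_norm_div {ζ w : ℂ} (hζ : ‖ζ‖ ≤ 1) (hw : ‖w‖ ≤ 1) (hne : w ≠ ζ) :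
    1 ≤ ‖(1 - conj ζ * w) / (w - ζ)‖ := by
  rw [norm_div, one_le_div (norm_pos_iff.2 (sub_ne_zero.2 hne))]
  refine le_of_sq_le_sq ?_ (norm_nonneg _)
  rw [← Complex.normSq_eq_norm_sq, ← Complex.normSq_eq_norm_sq]
  have h1 : Complex.normSq ζ ≤ 1 := by rw [Complex.normSq_eq_norm_sq]; nlinarith [norm_nonneg ζ]
  have h2 : Complex.normSq w ≤ 1 := by rw [Complex.normSq_eq_norm_sq]; nlinarith [norm_nonneg w]
  have h3 := mul_nonneg (sub_nonneg.2 h1) (sub_nonneg.2 h2)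
  -- The underlying identity is `|1 - conj ζ w|² - |w - ζ|² = (1 - |ζ|²)(1 - |w|²)`.
  simp only [Complex.normSq_apply] at *
  simp
  nlinarith

/-- The function `log |1 - conj ζ w|` is harmonic and vanishes at `0`, and `log |w - ζ|` has mean
`log t` with `t = max r |ζ|`. So the mean of the kernel is `-2 log t / (1 - |ζ|²)`, which is at most
`1 / t` since `1 - t² ≤ 1 - |ζ|²`: a bound uniform in `ζ`. -/
theorem lintegral_greenKernel_le {ζ : ℂ} (hζ : ‖ζ‖ < 1) {r : ℝ} (h0 : 0 < r) (h1 : r < 1) :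
    ∫⁻ θ, greenKernel ζ (polarPoint r θ) ∂angleMeasure ≤ ENNReal.ofReal (1 / r) := by
  have hζ2 : 0 < 1 - ‖ζ‖ ^ 2 := by nlinarith [norm_nonneg ζ]
  set f : ℂ → ℂ := fun w => (1 - conj ζ * w) / (w - ζ) with hf
  set F : ℂ → ℝ := fun w => Real.log (‖f w‖ ^ 2) / (1 - ‖ζ‖ ^ 2) with hF
  have hF' : F = fun w => (2 / (1 - ‖ζ‖ ^ 2)) * Real.log ‖f w‖ := by
    funext w
    simp only [hF, Real.log_pow]
    push_cast
    ring
  have hint : CircleIntegrable (fun w => Real.log ‖f w‖) 0 r :=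
    MeromorphicOn.circleIntegrable_log_norm (fun w _ => by simp only [hf]; fun_prop)
  have hFint : CircleIntegrable F 0 r := by
    rw [hF']
    exact IntervalIntegrable.const_mul hint _
  have hF0 : ∀ θ, 0 ≤ F (polarPoint r θ) := fun θ => by
    refine div_nonneg ?_ hζ2.le
    by_cases hne : polarPoint r θ = ζ
    · simp [hf, hne]
    · refine Real.log_nonneg (one_le_pow₀ (one_le_norm_div hζ.le ?_ hne))
      rw [norm_polarPoint, abs_of_pos h0]
      exact h1.le
  have havg : Real.circleAverage (fun w => Real.log ‖f w‖) 0 r = -Real.log (max r ‖ζ‖) := by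
    rw [circleAverage_congr_of_ne h0 ζ
      (G := (fun w => Real.log ‖1 - conj ζ * w‖) - fun w => Real.log ‖w - ζ‖),
      Real.circleAverage_sub, circleAverage_log_norm_one_sub hζ.le h0 h1,
      circleAverage_log_norm_sub h0, zero_sub]
    · exact MeromorphicOn.circleIntegrable_log_norm (fun w _ => by fun_prop)
    · exact circleIntegrable_log_norm_sub_const r
    · intro w hw hne
      rw [hf, Pi.sub_apply, norm_div, Real.log_div
        (norm_ne_zero_iff.2 (one_sub_conj_mul_ne_zero hζ.le (hw ▸ h1)))
        (norm_ne_zero_iff.2 (sub_ne_zero.2 hne))]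
  calc ∫⁻ θ, greenKernel ζ (polarPoint r θ) ∂angleMeasure
      = ∫⁻ θ, ENNReal.ofReal (F (polarPoint r θ)) ∂angleMeasure := by
        refine lintegral_congr_ae ?_
        filter_upwards [ae_angleMeasure_of_ae (ae_polarPoint_ne h0.ne' ζ)] with θ hθ
        rw [greenKernel, if_neg hθ]
    _ = ENNReal.ofReal (Real.circleAverage F 0 r) := lintegral_angleMeasure_ofReal hFint hF0
    _ ≤ ENNReal.ofReal (1 / r) := by
        refine ENNReal.ofReal_le_ofReal ?_
        rw [hF', show (fun w => (2 / (1 - ‖ζ‖ ^ 2)) * Real.log ‖f w‖) =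
          (2 / (1 - ‖ζ‖ ^ 2)) • fun w => Real.log ‖f w‖ from rfl, Real.circleAverage_smul, havg,
          smul_eq_mul]
        set t := max r ‖ζ‖ with ht
        have ht0 : 0 < t := lt_max_of_lt_left h0
        have ht1 : t ≤ 1 := max_le h1.le hζ.le
        calc 2 / (1 - ‖ζ‖ ^ 2) * -Real.log t = -(2 * Real.log t) / (1 - ‖ζ‖ ^ 2) := by ring
          _ ≤ (1 - t ^ 2) / t / (1 - ‖ζ‖ ^ 2) := by gcongr; exact neg_two_mul_log_le ht0 ht1
          _ ≤ (1 - ‖ζ‖ ^ 2) / t / (1 - ‖ζ‖ ^ 2) := by gcongr; exact le_max_right _ _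
          _ = 1 / t := by field_simp
          _ ≤ 1 / r := by gcongr; exact le_max_left _ _

/-- The kernel is the real part of `(ζ + w) / (ζ - w)`, holomorphic on `|w| ≤ r` with value `1` at
the centre. -/
theorem lintegral_poissonKernel_eq {ζ : ℂ} (hζ : ‖ζ‖ = 1) {r : ℝ} (h0 : 0 < r) (h1 : r < 1) :
    ∫⁻ θ, poissonKernel ζ (polarPoint r θ) ∂angleMeasure = 1 := by
  have hne : ∀ w ∈ Metric.closedBall (0 : ℂ) r, ζ - w ≠ 0 := fun w hw h => by
    rw [mem_closedBall_zero_iff, ← sub_eq_zero.1 h, hζ] at hw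
    linarith
  set f : ℂ → ℂ := fun w => (ζ + w) / (ζ - w) with hf
  have hd : DifferentiableOn ℂ f (Metric.closedBall 0 r) := fun w hw => by
    have := hne w hw
    exact DifferentiableAt.differentiableWithinAt (by fun_prop (disch := exact this))
  have hci : CircleIntegrable f 0 r :=
    (hd.continuousOn.mono Metric.sphere_subset_closedBall).circleIntegrable h0.le
  have havg : Real.circleAverage (Complex.reCLM ∘ f) 0 r = 1 := by
    rw [Complex.reCLM.circleAverage_comp_comm hci, DiffContOnCl.circleAverage]
    · have : ζ ≠ 0 := fun h => by simp [h] at hζ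
      simp [hf, this]
    · rw [abs_of_pos h0]
      exact (hd.mono Metric.closure_ball_subset_closedBall).diffContOnCl
  have heq : ∀ w, (Complex.reCLM ∘ f) w = (1 - ‖w‖ ^ 2) / ‖ζ - w‖ ^ 2 := fun w => by
    have := congr_fun (_root_.poissonKernel_eq_re_herglotzRieszKernel (c := 0) (w := w)) ζ
    simp only [_root_.poissonKernel, herglotzRieszKernel, sub_zero, Function.comp_apply, hζ,
      one_pow] at this
    exact this.symm
  have hlin := lintegral_angleMeasure_ofReal (F := Complex.reCLM ∘ f) (r := r)
    ((Complex.reCLM.continuous.comp_continuousOn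
      (hd.continuousOn.mono Metric.sphere_subset_closedBall)).circleIntegrable h0.le)
    (fun θ => by
      rw [heq, norm_polarPoint, abs_of_pos h0]
      have : r ^ 2 ≤ 1 := by nlinarith
      exact div_nonneg (by linarith) (by positivity))
  rw [havg, ENNReal.ofReal_one] at hlin
  simpa only [heq, poissonKernel] using hlin

theorem lintegral_weight_polarPoint_le (μ : Measure closedDisc) [IsFiniteMeasure μ] {r : ℝ}
    (h0 : 0 < r) (h1 : r < 1) :
    ∫⁻ θ, weight μ (polarPoint r θ) ∂angleMeasure ≤ μ Set.univ * ENNReal.ofReal (1 / r) := by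
  have hpm : Measurable fun p : ℝ × closedDisc => ((p.2 : ℂ), polarPoint r p.1) :=
    (measurable_subtype_coe.comp measurable_snd).prodMk
      ((continuous_polarPoint r).measurable.comp measurable_fst)
  have hg : Measurable fun p : ℝ × closedDisc => greenKernel p.2 (polarPoint r p.1) :=
    measurable_greenKernel.comp (f := fun p : ℝ × closedDisc => ((p.2 : ℂ), polarPoint r p.1)) hpm
  have hp : Measurable fun p : ℝ × closedDisc => poissonKernel p.2 (polarPoint r p.1) :=
    measurable_poissonKernel.comp (f := fun p : ℝ × closedDisc => ((p.2 : ℂ), polarPoint r p.1)) hpm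
  set S : Set closedDisc := {ζ | ‖(ζ : ℂ)‖ < 1} with hS
  set T : Set closedDisc := {ζ | ‖(ζ : ℂ)‖ = 1} with hT
  have hSm : MeasurableSet S := measurableSet_lt (by fun_prop) measurable_const
  have hTm : MeasurableSet T := measurableSet_eq_fun (by fun_prop) measurable_const
  have hdisj : Disjoint S T := Set.disjoint_left.2 fun x hx hx' => hx.out.ne hx'
  have hr1 : (1 : ℝ) ≤ 1 / r := by rw [le_div_iff₀ h0]; linarith
  have hswapG : ∫⁻ θ, ∫⁻ ζ in S, greenKernel ζ (polarPoint r θ) ∂μ ∂angleMeasure =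
      ∫⁻ ζ in S, ∫⁻ θ, greenKernel ζ (polarPoint r θ) ∂angleMeasure ∂μ :=
    lintegral_lintegral_swap hg.aemeasurable
  have hswapP : ∫⁻ θ, ∫⁻ ζ in T, poissonKernel ζ (polarPoint r θ) ∂μ ∂angleMeasure =
      ∫⁻ ζ in T, ∫⁻ θ, poissonKernel ζ (polarPoint r θ) ∂angleMeasure ∂μ :=
    lintegral_lintegral_swap hp.aemeasurable
  have hGm : Measurable fun θ => ∫⁻ ζ in S, greenKernel ζ (polarPoint r θ) ∂μ :=
    hg.lintegral_prod_right'
  have hsplit : ∫⁻ θ, weight μ (polarPoint r θ) ∂angleMeasure =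
      ∫⁻ θ, ∫⁻ ζ in S, greenKernel ζ (polarPoint r θ) ∂μ ∂angleMeasure +
        ∫⁻ θ, ∫⁻ ζ in T, poissonKernel ζ (polarPoint r θ) ∂μ ∂angleMeasure :=
    lintegral_add_left hGm _
  rw [hsplit, hswapG, hswapP]
  calc _ ≤ ∫⁻ ζ in S, ENNReal.ofReal (1 / r) ∂μ + ∫⁻ ζ in T, ENNReal.ofReal (1 / r) ∂μ := by
        refine add_le_add (setLIntegral_mono' hSm fun ζ hζ => lintegral_greenKernel_le hζ h0 h1)
          (setLIntegral_mono' hTm fun ζ hζ => ?_)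
        rw [lintegral_poissonKernel_eq hζ h0 h1, ← ENNReal.ofReal_one]
        exact ENNReal.ofReal_le_ofReal hr1
    _ = ∫⁻ ζ in S ∪ T, ENNReal.ofReal (1 / r) ∂μ := (lintegral_union hTm hdisj).symm
    _ ≤ ∫⁻ ζ, ENNReal.ofReal (1 / r) ∂μ := setLIntegral_le_lintegral _ _
    _ = _ := by rw [lintegral_const, mul_comm]

/-! ### The Carleson embedding. -/

theorem ae_areaMeasure_mem_disc : ∀ᵐ z ∂areaMeasure, z ∈ disc :=
  Measure.ae_smul_measure (ae_restrict_mem isOpen_disc.measurableSet) _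

/-- The measure `U_μ dA` is a Carleson measure for the Hardy space of the disc. -/
theorem lintegral_enorm_sq_mul_weight_le (μ : Measure closedDisc) [IsFiniteMeasure μ] {h : ℂ → ℂ}
    (hh : DifferentiableOn ℂ h disc) :
    ∫⁻ z, ‖h z‖ₑ ^ 2 * weight μ z ∂areaMeasure ≤
      8 * μ Set.univ * ⨆ r ∈ Set.Ioo (0 : ℝ) 1, circleMean h r := by
  set a := taylorCoeff h
  -- As a majorant of `|h|` depending only on `|z|`, `A` comes out of the angular integral, so only
  -- the circle means of the weight matter. Their bound `μ(closed disc) / r` meets the Jacobian `2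
  -- r`; the constant is `8 = 2 · 4`.
  set A : ℝ → ℝ≥0∞ := fun r => ∑' n, ‖a n‖ₑ * ENNReal.ofReal r ^ n with hA
  have hAm : Measurable A := by
    refine Measurable.tsum fun n => ?_
    fun_prop
  have hwm := measurable_weight μ
  calc ∫⁻ z, ‖h z‖ₑ ^ 2 * weight μ z ∂areaMeasure
      ≤ ∫⁻ z, A ‖z‖ ^ 2 * weight μ z ∂areaMeasure := by
        refine lintegral_mono_ae ?_
        filter_upwards [ae_areaMeasure_mem_disc] with z hz
        gcongr
        simp only [hA, ofReal_norm]
        exact enorm_le_tsum hh hz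
    _ = ∫⁻ r in Set.Ioo (0 : ℝ) 1, ENNReal.ofReal (2 * r) *
          ∫⁻ θ, A ‖polarPoint r θ‖ ^ 2 * weight μ (polarPoint r θ) ∂angleMeasure :=
        lintegral_areaMeasure (by fun_prop)
    _ ≤ ∫⁻ r in Set.Ioo (0 : ℝ) 1, 2 * μ Set.univ * A r ^ 2 := by
        refine setLIntegral_mono' measurableSet_Ioo fun r hr => ?_
        simp only [norm_polarPoint, abs_of_pos hr.1]
        have hwr : Measurable fun θ => weight μ (polarPoint r θ) :=
          hwm.comp (continuous_polarPoint r).measurable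
        rw [lintegral_const_mul _ hwr]
        calc _ ≤ ENNReal.ofReal (2 * r) * (A r ^ 2 * (μ Set.univ * ENNReal.ofReal (1 / r))) := by
              gcongr
              exact lintegral_weight_polarPoint_le μ hr.1 hr.2
          _ = (ENNReal.ofReal (2 * r) * ENNReal.ofReal (1 / r)) * (μ Set.univ * A r ^ 2) := by ring
          _ = _ := by
              rw [← ENNReal.ofReal_mul (by linarith [hr.1])]
              have : 2 * r * (1 / r) = 2 := by have := hr.1.ne'; field_simp
              rw [this, ENNReal.ofReal_ofNat, mul_assoc]
    _ = 2 * μ Set.univ * ∫⁻ r in Set.Ioo (0 : ℝ) 1, A r ^ 2 :=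
        lintegral_const_mul _ (by fun_prop)
    _ ≤ 2 * μ Set.univ * (4 * ∑' n, ‖a n‖ₑ ^ 2) := by
        gcongr
        exact lintegral_sq_tsum_le _ fun n => enorm_ne_top
    _ ≤ 2 * μ Set.univ * (4 * ⨆ r ∈ Set.Ioo (0 : ℝ) 1, circleMean h r) := by
        gcongr
        exact tsum_sq_taylorCoeff_le hh
    _ = _ := by ring

/-! ### Holomorphic division and partial derivatives in two variables. -/

/-- Joint holomorphy comes from differentiation under the integral sign. The free factor `φ` lets
one statement serve both the quotient by `z₁ - a` and the formula for `∂₂`. -/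
theorem differentiableOn_circleIntegral_div {f : ℂ × ℂ → ℂ} (hf : DifferentiableOn ℂ f bidisc)
    {c : ℂ} {R : ℝ} (hR : 0 < R) (hcR : Metric.closedBall c R ⊆ disc) {φ : ℂ → ℂ}
    (hφ : ContinuousOn φ (Metric.sphere c R)) :
    DifferentiableOn ℂ (fun p : ℂ × ℂ => ∮ w in C(c, R), φ w * f (w, p.2) * (w - p.1)⁻¹)
      (Metric.ball c R ×ˢ disc) := by
  rintro ⟨a, b⟩ ⟨ha, hb⟩
  refine DifferentiableAt.differentiableWithinAt ?_
  have hopen : IsOpen (Metric.ball c R ×ˢ disc) := Metric.isOpen_ball.prod isOpen_disc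
  obtain ⟨ε, hε, hεs⟩ := Metric.nhds_basis_closedBall.mem_iff.1
    (hopen.mem_nhds (show (a, b) ∈ Metric.ball c R ×ˢ disc from ⟨ha, hb⟩))
  have hsph : Metric.sphere c R ⊆ disc := Metric.sphere_subset_closedBall.trans hcR
  set H : ℂ → ℂ × ℂ → ℂ := fun w p => φ w * f (w, p.2) * (w - p.1)⁻¹ with hH
  have hne : ∀ w ∈ Metric.sphere c R, ∀ p ∈ Metric.ball c R ×ˢ disc, w - p.1 ≠ 0 := by
    intro w hw p hp h
    rw [sub_eq_zero.1 h] at hw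
    exact (Metric.mem_ball.1 hp.1).ne (Metric.mem_sphere.1 hw)
  have hfd : ∀ w ∈ disc, ∀ z ∈ disc, DifferentiableAt ℂ f (w, z) := fun w hw z hz =>
    hf.differentiableAt (isOpen_bidisc.mem_nhds ⟨hw, hz⟩)
  have hHd : ∀ w ∈ Metric.sphere c R, ∀ p ∈ Metric.ball c R ×ˢ disc,
      DifferentiableAt ℂ (H w) p := by
    intro w hw p hp
    have h1 : DifferentiableAt ℂ (fun p : ℂ × ℂ => f (w, p.2)) p :=
      (hfd w (hsph hw) p.2 hp.2).comp p (f := fun p : ℂ × ℂ => (w, p.2)) (by fun_prop)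
    have h2 := hne w hw p hp
    simp only [hH]
    exact (h1.const_mul _).mul (DifferentiableAt.inv (by fun_prop) h2)
  have hHc : ContinuousOn (fun q : ℂ × (ℂ × ℂ) => H q.1 q.2)
      (Metric.sphere c R ×ˢ Metric.closedBall (a, b) ε) := by
    have h1 : ContinuousOn (fun q : ℂ × (ℂ × ℂ) => f (q.1, q.2.2))
        (Metric.sphere c R ×ˢ Metric.closedBall (a, b) ε) :=
      hf.continuousOn.comp (by fun_prop) fun q hq => ⟨hsph hq.1, (hεs hq.2).2⟩
    have h2 : ContinuousOn (fun q : ℂ × (ℂ × ℂ) => φ q.1)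
        (Metric.sphere c R ×ˢ Metric.closedBall (a, b) ε) :=
      hφ.comp continuousOn_fst fun q hq => hq.1
    exact (h2.mul h1).mul (ContinuousOn.inv₀ (by fun_prop) fun q hq => hne _ hq.1 _ (hεs hq.2))
  obtain ⟨B, hB⟩ := ((isCompact_sphere c R).prod
    (isCompact_closedBall (a, b) ε)).exists_bound_of_continuousOn hHc
  have hcm : ∀ θ, circleMap c R θ ∈ Metric.sphere c R := circleMap_mem_sphere c hR.le
  have hcont : ∀ p ∈ Metric.closedBall (a, b) ε, Continuous fun θ => H (circleMap c R θ) p :=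
    fun p hp => hHc.comp_continuous (f := fun θ => (circleMap c R θ, p)) (by fun_prop)
      fun θ => ⟨hcm θ, hp⟩
  have hdc : Continuous (deriv (circleMap c R)) := by
    have : deriv (circleMap c R) = fun θ => circleMap 0 R θ * Complex.I := by
      funext θ; exact deriv_circleMap c R θ
    rw [this]
    fun_prop
  have hsmall : ∀ p ∈ Metric.ball (a, b) (ε / 2), ∀ q ∈ Metric.ball p (ε / 2),
      q ∈ Metric.closedBall (a, b) ε := by
    intro p hp q hq
    rw [Metric.mem_ball] at hp hq
    rw [Metric.mem_closedBall]
    linarith [dist_triangle q p (a, b)]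
  have hpε : ∀ p ∈ Metric.ball (a, b) (ε / 2), p ∈ Metric.closedBall (a, b) ε := fun p hp =>
    hsmall p hp p (Metric.mem_ball_self (by linarith))
  have hkey : HasFDerivAt (fun p : ℂ × ℂ => ∫ θ in (0 : ℝ)..2 * Real.pi,
      deriv (circleMap c R) θ • H (circleMap c R θ) p)
      (∫ θ in (0 : ℝ)..2 * Real.pi,
        deriv (circleMap c R) θ • fderiv ℂ (H (circleMap c R θ)) (a, b)) (a, b) := by
    -- Since `|H| ≤ B`, each `H w` maps the ball of radius `ε / 2` about `p` into the ball of radius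
    -- `B + B` about `H w p`; the Schwarz lemma then bounds the derivative, and `R` is the speed of
    -- the circle.
    refine intervalIntegral.hasFDerivAt_integral_of_dominated_of_fderiv_le
      (F' := fun p θ => deriv (circleMap c R) θ • fderiv ℂ (H (circleMap c R θ)) p)
      (bound := fun _ => R * ((B + B) / (ε / 2))) (Metric.ball_mem_nhds (a, b) (half_pos hε))
      ?_ ?_ ?_ ?_ ?_ ?_
    · filter_upwards [Metric.closedBall_mem_nhds (a, b) hε] with p hp
      exact (hdc.smul (hcont p hp)).aestronglyMeasurable
    · exact (hdc.smul (hcont _ (Metric.mem_closedBall_self hε.le))).intervalIntegrable _ _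
    · refine (hdc.aestronglyMeasurable).smul ?_
      have hform : ∀ θ, fderiv ℂ (H (circleMap c R θ)) (a, b) =
          (φ (circleMap c R θ) * f (circleMap c R θ, b)) •
            (((circleMap c R θ - a) ^ 2)⁻¹ • ContinuousLinearMap.fst ℂ ℂ ℂ) +
          (circleMap c R θ - a)⁻¹ • (φ (circleMap c R θ) •
            (fderiv ℂ f (circleMap c R θ, b)).comp
              ((0 : ℂ × ℂ →L[ℂ] ℂ).prod (ContinuousLinearMap.snd ℂ ℂ ℂ))) := by
        intro θ
        set w := circleMap c R θ
        have hw : w ∈ Metric.sphere c R := hcm θ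
        have hwa : w - a ≠ 0 := hne w hw (a, b) ⟨ha, hb⟩
        have h1 : HasFDerivAt (fun p : ℂ × ℂ => f (w, p.2)) ((fderiv ℂ f (w, b)).comp
            ((0 : ℂ × ℂ →L[ℂ] ℂ).prod (ContinuousLinearMap.snd ℂ ℂ ℂ))) (a, b) :=
          ((hfd w (hsph hw) b hb).hasFDerivAt).comp (a, b) (f := fun p : ℂ × ℂ => (w, p.2))
            ((hasFDerivAt_const w _).prodMk hasFDerivAt_snd)
        have h2 : HasDerivAt (fun x : ℂ => (w - x)⁻¹) (((w - a) ^ 2)⁻¹) a := by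
          have := HasDerivAt.fun_inv ((hasDerivAt_id' a).const_sub w) hwa
          rwa [neg_neg, one_div] at this
        have h3 := h2.comp_hasFDerivAt (a, b)
          (hasFDerivAt_fst (𝕜 := ℂ) (E := ℂ) (F := ℂ) (p := (a, b)))
        exact ((h1.const_mul (φ w)).mul h3).fderiv
      simp only [hform]
      have hcw : Continuous fun θ => circleMap c R θ := continuous_circleMap c R
      have hφc : Continuous fun θ => φ (circleMap c R θ) := hφ.comp_continuous hcw hcm
      have hfc : Continuous fun θ => f (circleMap c R θ, b) :=
        hf.continuousOn.comp_continuous (by fun_prop) fun θ => ⟨hsph (hcm θ), hb⟩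
      have hwa : Continuous fun θ => (circleMap c R θ - a)⁻¹ :=
        Continuous.inv₀ (by fun_prop) fun θ => hne _ (hcm θ) (a, b) ⟨ha, hb⟩
      have hfm : AEStronglyMeasurable (fun θ => fderiv ℂ f (circleMap c R θ, b))
          (volume.restrict (Set.uIoc 0 (2 * Real.pi))) :=
        ((measurable_fderiv ℂ f).comp (by fun_prop : Continuous fun θ =>
          (circleMap c R θ, b)).measurable).aestronglyMeasurable
      have hfm2 := ((ContinuousLinearMap.compL ℂ (ℂ × ℂ) (ℂ × ℂ) ℂ).flip
        ((0 : ℂ × ℂ →L[ℂ] ℂ).prod (ContinuousLinearMap.snd ℂ ℂ ℂ))).continuous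
        |>.comp_aestronglyMeasurable hfm
      have hsq : Continuous fun θ => ((circleMap c R θ - a) ^ 2)⁻¹ := by
        simp only [← inv_pow]
        exact hwa.pow 2
      refine AEStronglyMeasurable.add ?_ ?_
      · exact ((hφc.mul hfc).smul (hsq.smul continuous_const)).aestronglyMeasurable
      · exact hwa.aestronglyMeasurable.smul (hφc.aestronglyMeasurable.smul hfm2)
    · refine Eventually.of_forall fun θ _ p hp => ?_
      rw [norm_smul]
      have h1 : ‖deriv (circleMap c R) θ‖ = R := by simp [abs_of_pos hR]
      rw [h1]
      refine mul_le_mul_of_nonneg_left ?_ hR.le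
      refine Complex.norm_fderiv_le_div_of_mapsTo_ball (R₁ := ε / 2) ?_ ?_ (half_pos hε)
      · exact fun q hq => (hHd _ (hcm θ) q (hεs (hsmall p hp q hq))).differentiableWithinAt
      · intro q hq
        rw [mem_closedBall_iff_norm]
        exact (norm_sub_le _ _).trans (add_le_add
          (hB (circleMap c R θ, q) ⟨hcm θ, hsmall p hp q hq⟩)
          (hB (circleMap c R θ, p) ⟨hcm θ, hpε p hp⟩))
    · exact intervalIntegrable_const
    · exact Eventually.of_forall fun θ _ p hp =>
        (hHd _ (hcm θ) p (hεs (hpε p hp))).hasFDerivAt.fun_const_smul _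
  exact hkey.differentiableAt

theorem differentiableOn_slice₁ {f : ℂ × ℂ → ℂ} (hf : DifferentiableOn ℂ f bidisc) {z₂ : ℂ}
    (hz₂ : z₂ ∈ disc) : DifferentiableOn ℂ (fun w => f (w, z₂)) disc :=
  hf.comp (f := fun w => (w, z₂)) (by fun_prop) fun _ hw => ⟨hw, hz₂⟩

theorem differentiableOn_slice₂ {f : ℂ × ℂ → ℂ} (hf : DifferentiableOn ℂ f bidisc) {z₁ : ℂ}
    (hz₁ : z₁ ∈ disc) : DifferentiableOn ℂ (fun w => f (z₁, w)) disc :=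
  hf.comp (f := fun w => (z₁, w)) (by fun_prop) fun _ hw => ⟨hz₁, hw⟩

theorem differentiableOn_comp_swap {f : ℂ × ℂ → ℂ} (hf : DifferentiableOn ℂ f bidisc) :
    DifferentiableOn ℂ (fun z : ℂ × ℂ => f (z.2, z.1)) bidisc :=
  hf.comp (f := fun z : ℂ × ℂ => (z.2, z.1)) (by fun_prop) fun _ hz => ⟨hz.2, hz.1⟩

/-- A holomorphic function vanishing on the slice `{z₁ = a}` is divisible by `z₁ - a`. -/
theorem exists_eq_sub_mul {f : ℂ × ℂ → ℂ} (hf : DifferentiableOn ℂ f bidisc) {a : ℂ}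
    (ha : a ∈ disc) (h0 : ∀ z₂ ∈ disc, f (a, z₂) = 0) :
    ∃ g : ℂ × ℂ → ℂ, DifferentiableOn ℂ g bidisc ∧ (∀ z ∉ bidisc, g z = 0) ∧
      ∀ z ∈ bidisc, f z = (z.1 - a) * g z := by
  classical
  -- On a circle enclosing both `a` and `z₁` this slope is `f / (w - a)`, so Cauchy's formula writes
  -- `g₀` as a circle integral that is jointly holomorphic. Extension by zero off the bidisc makes
  -- the quotient Borel measurable on `ℂ × ℂ`.
  set g₀ : ℂ × ℂ → ℂ := fun z => dslope (fun w => f (w, z.2)) a z.1 with hg₀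
  refine ⟨bidisc.indicator g₀, ?_, fun z hz => Set.indicator_of_notMem hz _, fun z hz => ?_⟩
  · have : DifferentiableOn ℂ g₀ bidisc := by
      rintro p hp
      obtain ⟨R, hRl, hR1⟩ := exists_between (max_lt (mem_disc.1 hp.1) (mem_disc.1 ha))
      have hpR : ‖p.1‖ < R := (le_max_left _ _).trans_lt hRl
      have haR : ‖a‖ < R := (le_max_right _ _).trans_lt hRl
      have hR : 0 < R := (norm_nonneg _).trans_lt hpR
      have hcR : Metric.closedBall (0 : ℂ) R ⊆ disc := Metric.closedBall_subset_ball hR1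
      have hne : ∀ w ∈ Metric.sphere (0 : ℂ) R, w - a ≠ 0 := fun w hw h => by
        rw [mem_sphere_zero_iff_norm, sub_eq_zero.1 h] at hw
        linarith
      have hφ : ContinuousOn (fun w => (w - a)⁻¹) (Metric.sphere (0 : ℂ) R) :=
        ContinuousOn.inv₀ (by fun_prop) hne
      have hd := (differentiableOn_circleIntegral_div hf hR hcR hφ).const_smul
        ((2 * Real.pi * Complex.I : ℂ)⁻¹)
      have hmem : Metric.ball (0 : ℂ) R ×ˢ disc ∈ 𝓝 p :=
        (Metric.isOpen_ball.prod isOpen_disc).mem_nhds ⟨by simpa using hpR, hp.2⟩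
      refine ((hd.differentiableAt hmem).congr_of_eventuallyEq ?_).differentiableWithinAt
      filter_upwards [hmem] with q hq
      have hs : DifferentiableOn ℂ (dslope (fun w => f (w, q.2)) a) disc :=
        (Complex.differentiableOn_dslope (isOpen_disc.mem_nhds ha)).2
          (differentiableOn_slice₁ hf hq.2)
      have hC := (hs.mono hcR).circleIntegral_sub_inv_smul hq.1
      have hpi : (2 * Real.pi * Complex.I : ℂ) ≠ 0 := Complex.two_pi_I_ne_zero
      have heq : (∮ w in C(0, R), (w - a)⁻¹ * f (w, q.2) * (w - q.1)⁻¹) =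
          ∮ w in C(0, R), (w - q.1)⁻¹ • dslope (fun w => f (w, q.2)) a w := by
        refine circleIntegral.integral_congr hR.le fun w hw => ?_
        have hwa : w ≠ a := sub_ne_zero.1 (hne w hw)
        rw [dslope_of_ne _ hwa, slope_def_field, h0 _ hq.2, smul_eq_mul]
        ring
      simp only [Pi.smul_apply]
      rw [heq, hC, smul_eq_mul, smul_eq_mul, inv_mul_cancel_left₀ hpi]
    exact this.congr fun z hz => Set.indicator_of_mem hz _
  · rw [Set.indicator_of_mem hz]
    have := sub_smul_dslope (fun w => f (w, z.2)) a z.1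
    rw [smul_eq_mul, h0 _ hz.2, sub_zero] at this
    exact this.symm

/-- Cauchy's formula for the derivative at the centre `z₂`: one factor `(w - z₂)⁻¹` is `φ`, the
other is the Cauchy kernel evaluated at the centre. -/
theorem differentiableOn_partial₂ {g : ℂ × ℂ → ℂ} (hg : DifferentiableOn ℂ g bidisc) {z₂ : ℂ}
    (hz₂ : z₂ ∈ disc) : DifferentiableOn ℂ (fun z₁ => partial₂ g z₁ z₂) disc := by
  obtain ⟨R, hR, hcR⟩ := Metric.nhds_basis_closedBall.mem_iff.1 (isOpen_disc.mem_nhds hz₂)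
  have hne : ∀ w ∈ Metric.sphere z₂ R, w - z₂ ≠ 0 := fun w hw h => by
    rw [mem_sphere_iff_norm, h, norm_zero] at hw
    exact hR.ne hw
  have hφ : ContinuousOn (fun w => (w - z₂)⁻¹) (Metric.sphere z₂ R) :=
    ContinuousOn.inv₀ (by fun_prop) hne
  have hd := (differentiableOn_circleIntegral_div (differentiableOn_comp_swap hg) hR hcR
    hφ).const_smul ((2 * Real.pi * Complex.I : ℂ)⁻¹)
  have hd2 := hd.comp (f := fun z₁ : ℂ => (z₂, z₁)) (s := disc) (by fun_prop)
    fun z hz => ⟨Metric.mem_ball_self hR, hz⟩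
  refine hd2.congr fun z₁ hz₁ => ?_
  have hC := ((differentiableOn_slice₂ hg hz₁).mono hcR).deriv_eq_smul_circleIntegral hR
  have heq : (∮ w in C(z₂, R), (w - z₂)⁻¹ * g (z₁, w) * (w - z₂)⁻¹) =
      ∮ w in C(z₂, R), (1 / (w - z₂) ^ 2) • g (z₁, w) := by
    refine circleIntegral.integral_congr hR.le fun w hw => ?_
    rw [smul_eq_mul, one_div, ← inv_pow]
    ring
  simp only [Function.comp_apply, Pi.smul_apply]
  rw [heq, hC, smul_eq_mul, smul_eq_mul, inv_mul_cancel_left₀ Complex.two_pi_I_ne_zero]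
  rfl

theorem measurable_of_differentiableOn {g : ℂ × ℂ → ℂ} (hg : DifferentiableOn ℂ g bidisc)
    (h0 : ∀ z ∉ bidisc, g z = 0) : Measurable g :=
  measurable_of_restrict_of_restrict_compl isOpen_bidisc.measurableSet
    hg.continuousOn.domRestrict.measurable
    (by
      have : bidiscᶜ.domRestrict g = fun _ => 0 := funext fun z => h0 z z.2
      rw [this]
      exact measurable_const)

theorem measurable_indicator_partial₂ {g : ℂ × ℂ → ℂ} (hg : DifferentiableOn ℂ g bidisc)
    (hgm : Measurable g) :
    Measurable (bidisc.indicator fun z => partial₂ g z.1 z.2) := by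
  have hm : ∀ n : ℕ, Measurable (bidisc.indicator fun z : ℂ × ℂ =>
      ((1 / ((n : ℝ) + 1) : ℝ) : ℂ)⁻¹ *
        (g (z.1, z.2 + ((1 / ((n : ℝ) + 1) : ℝ) : ℂ)) - g (z.1, z.2))) := fun n => by
    refine Measurable.indicator ?_ isOpen_bidisc.measurableSet
    exact ((hgm.comp (by fun_prop)).sub (hgm.comp (by fun_prop))).const_mul _
  refine measurable_of_tendsto_metrizable hm (tendsto_pi_nhds.2 fun z => ?_)
  by_cases hz : z ∈ bidisc
  · simp only [Set.indicator_of_mem hz]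
    have hd : HasDerivAt (fun w => g (z.1, w)) (partial₂ g z.1 z.2) z.2 :=
      ((differentiableOn_slice₂ hg hz.1).differentiableAt
        (isOpen_disc.mem_nhds hz.2)).hasDerivAt
    have ht := hd.tendsto_slope_zero
    have hn : Tendsto (fun n : ℕ => ((1 / ((n : ℝ) + 1) : ℝ) : ℂ)) atTop (𝓝[≠] 0) := by
      refine tendsto_nhdsWithin_iff.2 ⟨?_, Eventually.of_forall fun n => ?_⟩
      · have := (Complex.continuous_ofReal.tendsto 0).comp
          (tendsto_one_div_add_atTop_nhds_zero_nat (𝕜 := ℝ))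
        simpa [Function.comp_def] using this
      · have : (1 / ((n : ℝ) + 1) : ℝ) ≠ 0 := by positivity
        exact Complex.ofReal_ne_zero.2 this
    simpa only [smul_eq_mul, Function.comp_def] using ht.comp hn
  · simp only [Set.indicator_of_notMem hz]
    exact tendsto_const_nhds

/-! ### The one-variable division estimate. -/

theorem norm_deriv_le_of_taylorCoeff_le {k : ℂ → ℂ} (hk : DifferentiableOn ℂ k disc) {s ρ : ℝ}
    (hs : ∀ n, ‖taylorCoeff k n‖ ≤ s) (hρ : ρ < 1) {z : ℂ} (hz : ‖z‖ < ρ) :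
    ‖deriv k z‖ ≤ 8 / (1 - ρ) ^ 2 * s := by
  have hs0 : 0 ≤ s := (norm_nonneg _).trans (hs 0)
  have hρ0 : 0 < ρ := (norm_nonneg z).trans_lt hz
  -- The disc of radius `d` about `z` stays in `|w| < 1 - d`, where the geometric series gives `|k|
  -- ≤ s / d`; the derivative is then at most `2 (s / d) / d`.
  set d := (1 - ρ) / 2 with hd
  have hd0 : 0 < d := by rw [hd]; linarith
  have hbound : ∀ w : ℂ, ‖w‖ < 1 - d → ‖k w‖ ≤ s / d := by
    intro w hw
    have hw1 : ‖w‖ < 1 := by linarith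
    have hsum := hasSum_taylorCoeff hk (mem_disc.2 hw1)
    have hgeo := (hasSum_geometric_of_lt_one (norm_nonneg w) hw1).mul_left s
    refine (hsum.norm_le_of_bounded hgeo fun n => ?_).trans ?_
    · rw [norm_mul, norm_pow]
      exact mul_le_mul_of_nonneg_right (hs n) (by positivity)
    · rw [div_eq_mul_inv]
      gcongr
      linarith
  have hball : ∀ w ∈ Metric.ball z d, ‖w‖ < 1 - d := fun w hw => by
    rw [mem_ball_iff_norm] at hw
    have := norm_add_le (w - z) z
    rw [sub_add_cancel] at this
    linarith
  have := Complex.norm_deriv_le_div_of_mapsTo_ball (f := k) (c := z) (R₁ := d)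
    (R₂ := s / d + s / d)
    (hk.mono fun w hw => mem_disc.2 (by linarith [hball w hw]))
    (fun w hw => by
      rw [mem_closedBall_iff_norm]
      exact (norm_sub_le _ _).trans (add_le_add (hbound w (hball w hw))
        (hbound z (hball z (Metric.mem_ball_self hd0))))) hd0
  refine this.trans (le_of_eq ?_)
  have : 1 - ρ ≠ 0 := by linarith
  rw [hd]
  field_simp
  ring

theorem enorm_deriv_sq_le {k : ℂ → ℂ} (hk : DifferentiableOn ℂ k disc) {ρ : ℝ}
    (hρ : ρ < 1) {z : ℂ} (hz : ‖z‖ < ρ) :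
    ‖deriv k z‖ₑ ^ 2 ≤ ENNReal.ofReal (8 / (1 - ρ) ^ 2) ^ 2 *
      ⨆ r ∈ Set.Ioo (0 : ℝ) 1, circleMean k r := by
  set S := ⨆ r ∈ Set.Ioo (0 : ℝ) 1, circleMean k r
  have h1 : 0 < 1 - ρ := by linarith
  have hK : 0 < 8 / (1 - ρ) ^ 2 := by positivity
  rcases eq_or_ne S ⊤ with hS | hS
  · rw [hS, ENNReal.mul_top (pow_ne_zero 2 (by simpa using hK))]
    exact le_top
  · have hsq : ENNReal.ofReal (Real.sqrt S.toReal) ^ 2 = S := by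
      rw [← ENNReal.ofReal_pow (Real.sqrt_nonneg _), Real.sq_sqrt ENNReal.toReal_nonneg,
        ENNReal.ofReal_toReal hS]
    have hs : ∀ n, ‖taylorCoeff k n‖ ≤ Real.sqrt S.toReal := fun n => by
      have h2 : ‖taylorCoeff k n‖ₑ ^ 2 ≤ ENNReal.ofReal (Real.sqrt S.toReal) ^ 2 := by
        rw [hsq]
        exact (ENNReal.le_tsum n).trans (tsum_sq_taylorCoeff_le hk)
      rw [ENNReal.pow_le_pow_left_iff two_ne_zero, ← ofReal_norm] at h2
      exact (ENNReal.ofReal_le_ofReal_iff (Real.sqrt_nonneg _)).1 h2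
    rw [← hsq, ← mul_pow, ← ENNReal.ofReal_mul hK.le, ← ofReal_norm]
    gcongr
    exact norm_deriv_le_of_taylorCoeff_le hk hs hρ hz

theorem circleMean_one (r : ℝ) : circleMean (fun _ => 1) r = 1 := by
  simp [circleMean]

theorem lintegral_weight_le (μ : Measure closedDisc) [IsFiniteMeasure μ] :
    ∫⁻ z, weight μ z ∂areaMeasure ≤ 8 * μ Set.univ := by
  have h := lintegral_enorm_sq_mul_weight_le μ (h := fun _ => 1) (differentiableOn_const _)
  simp only [enorm_one, one_pow, one_mul, circleMean_one] at h
  refine h.trans ?_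
  calc 8 * μ Set.univ * ⨆ r ∈ Set.Ioo (0 : ℝ) 1, (1 : ℝ≥0∞) ≤ 8 * μ Set.univ * 1 := by
        gcongr
        exact iSup₂_le fun _ _ => le_rfl
    _ = _ := mul_one _

theorem aemeasurable_areaMeasure {h : ℂ → ℂ} (hh : ContinuousOn h disc) :
    AEMeasurable h areaMeasure :=
  (hh.aemeasurable isOpen_disc.measurableSet).smul_measure _

/-- The one-variable division estimate in Dirichlet-type spaces. -/
theorem exists_division_bound {a : ℂ} (ha : a ∈ disc) :
    ∃ C : ℝ≥0∞, C ≠ ⊤ ∧ ∀ (μ : Measure closedDisc) [IsFiniteMeasure μ] (h k : ℂ → ℂ),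
      DifferentiableOn ℂ k disc → (∀ z ∈ disc, h z = (z - a) * k z) →
      ∫⁻ z, ‖deriv k z‖ₑ ^ 2 * weight μ z ∂areaMeasure ≤
        C * (∫⁻ z, ‖deriv h z‖ₑ ^ 2 * weight μ z ∂areaMeasure +
          μ Set.univ * ⨆ r ∈ Set.Ioo (0 : ℝ) 1, circleMean k r) := by
  rw [mem_disc] at ha
  set ρ := (1 + ‖a‖) / 2 with hρdef
  have hρ : ρ < 1 := by rw [hρdef]; linarith
  set δ := (1 - ‖a‖) / 2 with hδdef
  have hδ : 0 < δ := by rw [hδdef]; linarith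
  set K₁ := ENNReal.ofReal (2 * δ⁻¹ ^ 2) with hK₁
  set K₂ := ENNReal.ofReal (8 / (1 - ρ) ^ 2) ^ 2 with hK₂
  have hK₁t : K₁ ≠ ⊤ := ENNReal.ofReal_ne_top
  have hK₂t : K₂ ≠ ⊤ := ENNReal.pow_ne_top ENNReal.ofReal_ne_top
  refine ⟨8 * (K₁ + K₂), ENNReal.mul_ne_top (by simp) (ENNReal.add_ne_top.2 ⟨hK₁t, hK₂t⟩), ?_⟩
  intro μ _ h k hk hhk
  set S := ⨆ r ∈ Set.Ioo (0 : ℝ) 1, circleMean k r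
  -- For `|z| < ρ` the derivative is controlled by the Hardy norm alone; for `|z| ≥ ρ` one has `|z -
  -- a| ≥ δ` and `(z - a) k' = h' - k`.
  have hpt : ∀ z ∈ disc, ‖deriv k z‖ₑ ^ 2 ≤
      K₁ * ‖deriv h z‖ₑ ^ 2 + (K₁ * ‖k z‖ₑ ^ 2 + K₂ * S) := by
    intro z hz
    rcases lt_or_ge ‖z‖ ρ with hzρ | hzρ
    · exact (enorm_deriv_sq_le hk hρ hzρ).trans (le_add_left le_add_self)
    · have hd : deriv h z = k z + (z - a) * deriv k z := by
        have hev : h =ᶠ[𝓝 z] fun w => (w - a) * k w :=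
          eventually_of_mem (isOpen_disc.mem_nhds hz) hhk
        have hkd := (hk.differentiableAt (isOpen_disc.mem_nhds hz)).hasDerivAt
        rw [hev.deriv_eq, (((hasDerivAt_id' z).sub_const a).fun_mul hkd).deriv, one_mul]
      have hza : δ ≤ ‖z - a‖ := by
        have := norm_sub_norm_le z a
        linarith
      have hn : δ * ‖deriv k z‖ ≤ ‖deriv h z‖ + ‖k z‖ := by
        calc δ * ‖deriv k z‖ ≤ ‖z - a‖ * ‖deriv k z‖ := by gcongr
          _ = ‖deriv h z - k z‖ := by rw [← norm_mul, hd]; congr 1; ring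
          _ ≤ _ := norm_sub_le _ _
      have hreal : ‖deriv k z‖ ^ 2 ≤ 2 * δ⁻¹ ^ 2 * ‖deriv h z‖ ^ 2 + 2 * δ⁻¹ ^ 2 * ‖k z‖ ^ 2 := by
        have h1 : ‖deriv k z‖ ≤ δ⁻¹ * (‖deriv h z‖ + ‖k z‖) := by
          rw [← div_eq_inv_mul, le_div_iff₀ hδ, mul_comm]; exact hn
        calc ‖deriv k z‖ ^ 2 ≤ (δ⁻¹ * (‖deriv h z‖ + ‖k z‖)) ^ 2 := by gcongr
          _ ≤ _ := by
            nlinarith [mul_nonneg (sq_nonneg δ⁻¹) (sq_nonneg (‖deriv h z‖ - ‖k z‖))]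
      have henn := ENNReal.ofReal_le_ofReal hreal
      rw [ENNReal.ofReal_add (by positivity) (by positivity),
        ENNReal.ofReal_mul (p := 2 * δ⁻¹ ^ 2) (by positivity),
        ENNReal.ofReal_mul (p := 2 * δ⁻¹ ^ 2) (by positivity),
        ENNReal.ofReal_pow (norm_nonneg _), ENNReal.ofReal_pow (norm_nonneg _),
        ENNReal.ofReal_pow (norm_nonneg _), ofReal_norm, ofReal_norm, ofReal_norm] at henn
      exact henn.trans (add_le_add le_rfl le_self_add)
  have hwm := measurable_weight μ
  have hkm : AEMeasurable (fun z => ‖k z‖ₑ ^ 2 * weight μ z) areaMeasure :=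
    ((aemeasurable_areaMeasure hk.continuousOn).enorm.pow_const 2).mul hwm.aemeasurable
  calc ∫⁻ z, ‖deriv k z‖ₑ ^ 2 * weight μ z ∂areaMeasure
      ≤ ∫⁻ z, (K₁ * (‖deriv h z‖ₑ ^ 2 * weight μ z) +
          (K₁ * (‖k z‖ₑ ^ 2 * weight μ z) + K₂ * S * weight μ z)) ∂areaMeasure := by
        refine lintegral_mono_ae ?_
        filter_upwards [ae_areaMeasure_mem_disc] with z hz
        refine (mul_le_mul_left (hpt z hz) (weight μ z)).trans (le_of_eq ?_)
        ring
    _ = K₁ * ∫⁻ z, ‖deriv h z‖ₑ ^ 2 * weight μ z ∂areaMeasure +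
          (K₁ * ∫⁻ z, ‖k z‖ₑ ^ 2 * weight μ z ∂areaMeasure +
            K₂ * S * ∫⁻ z, weight μ z ∂areaMeasure) := by
        have hm : AEMeasurable (fun z => K₁ * (‖k z‖ₑ ^ 2 * weight μ z) + K₂ * S * weight μ z)
            areaMeasure := (hkm.const_mul _).add (hwm.const_mul _).aemeasurable
        rw [lintegral_add_right' _ hm, lintegral_add_right' _ (hwm.const_mul _).aemeasurable,
          lintegral_const_mul' _ _ hK₁t, lintegral_const_mul' _ _ hK₁t,
          lintegral_const_mul _ hwm]
    _ ≤ K₁ * ∫⁻ z, ‖deriv h z‖ₑ ^ 2 * weight μ z ∂areaMeasure +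
          (K₁ * (8 * μ Set.univ * S) + K₂ * S * (8 * μ Set.univ)) := by
        gcongr
        · exact lintegral_enorm_sq_mul_weight_le μ hk
        · exact lintegral_weight_le μ
    _ = K₁ * ∫⁻ z, ‖deriv h z‖ₑ ^ 2 * weight μ z ∂areaMeasure +
          8 * (K₁ + K₂) * (μ Set.univ * S) := by ring
    _ ≤ 8 * (K₁ + K₂) * ∫⁻ z, ‖deriv h z‖ₑ ^ 2 * weight μ z ∂areaMeasure +
          8 * (K₁ + K₂) * (μ Set.univ * S) := by
        gcongr
        calc K₁ ≤ K₁ + K₂ := le_self_add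
          _ = 1 * (K₁ + K₂) := (one_mul _).symm
          _ ≤ 8 * (K₁ + K₂) := by gcongr; norm_num
    _ = _ := by ring

/-! ### Torus means and Hardy norms of slices. -/

/-- The mean of `‖f‖²` over the torus with radii `r` and `s`. -/
def torusMean (f : ℂ × ℂ → ℂ) (r s : ℝ) : ℝ≥0∞ :=
  ∫⁻ θ₁, ∫⁻ θ₂, ‖f (polarPoint r θ₁, polarPoint s θ₂)‖ₑ ^ 2 ∂angleMeasure ∂angleMeasure

theorem continuous_comp_polarPoint {f : ℂ × ℂ → ℂ} (hf : DifferentiableOn ℂ f bidisc) {r s : ℝ}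
    (hr : r ∈ Set.Ico (0 : ℝ) 1) (hs : s ∈ Set.Ico (0 : ℝ) 1) :
    Continuous fun p : ℝ × ℝ => f (polarPoint r p.1, polarPoint s p.2) :=
  hf.continuousOn.comp_continuous
    (((continuous_polarPoint r).comp continuous_fst).prodMk
      ((continuous_polarPoint s).comp continuous_snd))
    fun _ => ⟨polarPoint_mem_disc hr.1 hr.2 _, polarPoint_mem_disc hs.1 hs.2 _⟩

theorem torusMean_swap {f : ℂ × ℂ → ℂ} (hf : DifferentiableOn ℂ f bidisc) {r s : ℝ}
    (hr : r ∈ Set.Ico (0 : ℝ) 1) (hs : s ∈ Set.Ico (0 : ℝ) 1) :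
    torusMean f r s = torusMean (fun z => f (z.2, z.1)) s r := by
  have hc := continuous_comp_polarPoint hf hr hs
  have hm : Measurable fun p : ℝ × ℝ => ‖f (polarPoint r p.1, polarPoint s p.2)‖ₑ ^ 2 :=
    hc.measurable.enorm.pow_const 2
  exact lintegral_lintegral_swap hm.aemeasurable

theorem torusMean_mono_right {f : ℂ × ℂ → ℂ} (hf : DifferentiableOn ℂ f bidisc) {r s t : ℝ}
    (hr : r ∈ Set.Ico (0 : ℝ) 1) (hs : 0 ≤ s) (hst : s ≤ t) (ht : t < 1) :
    torusMean f r s ≤ torusMean f r t :=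
  lintegral_mono fun θ =>
    circleMean_mono (differentiableOn_slice₂ hf (polarPoint_mem_disc hr.1 hr.2 θ)) hs hst ht

theorem torusMean_mono_left {f : ℂ × ℂ → ℂ} (hf : DifferentiableOn ℂ f bidisc) {r s t : ℝ}
    (hr : r ∈ Set.Ico (0 : ℝ) 1) (hs : 0 ≤ s) (hst : s ≤ t) (ht : t < 1) :
    torusMean f s r ≤ torusMean f t r := by
  rw [torusMean_swap hf ⟨hs, hst.trans_lt ht⟩ hr, torusMean_swap hf ⟨hs.trans hst, ht⟩ hr]
  exact torusMean_mono_right (differentiableOn_comp_swap hf) hr hs hst ht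

theorem torusMean_le_hardyNormSq {f : ℂ × ℂ → ℂ} (hf : DifferentiableOn ℂ f bidisc) {r s : ℝ}
    (hr : r ∈ Set.Ioo (0 : ℝ) 1) (hs : s ∈ Set.Ioo (0 : ℝ) 1) :
    torusMean f r s ≤ hardyNormSq f := by
  have ht : max r s ∈ Set.Ioo (0 : ℝ) 1 := ⟨lt_max_of_lt_left hr.1, max_lt hr.2 hs.2⟩
  calc torusMean f r s ≤ torusMean f r (max r s) :=
        torusMean_mono_right hf ⟨hr.1.le, hr.2⟩ hs.1.le (le_max_right _ _) ht.2
    _ ≤ torusMean f (max r s) (max r s) :=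
        torusMean_mono_left hf ⟨ht.1.le, ht.2⟩ hr.1.le (le_max_left _ _) ht.2
    _ ≤ hardyNormSq f :=
        le_iSup₂ (f := fun r (_ : r ∈ Set.Ioo (0 : ℝ) 1) => torusMean f r r) _ ht

/-- A countable increasing family of radii suffices, which gives measurability in the slice
parameter and access to monotone convergence. -/
theorem iSup_circleMean_eq {h : ℂ → ℂ} (hh : DifferentiableOn ℂ h disc) :
    ⨆ r ∈ Set.Ioo (0 : ℝ) 1, circleMean h r =
      ⨆ n : ℕ, circleMean h (1 - 1 / ((n : ℝ) + 2)) := by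
  refine le_antisymm (iSup₂_le fun r hr => ?_) (iSup_le fun n => ?_)
  · obtain ⟨n, hn⟩ := exists_nat_gt (1 / (1 - r))
    have h1 : 0 < 1 - r := by linarith [hr.2]
    have hn2 : 1 / ((n : ℝ) + 2) ≤ 1 - r := by
      rw [div_lt_iff₀ h1] at hn
      rw [div_le_iff₀ (by positivity)]
      nlinarith
    have hpos : 0 < 1 / ((n : ℝ) + 2) := by positivity
    exact (circleMean_mono hh hr.1.le (by linarith) (by linarith)).trans
      (le_iSup (fun n : ℕ => circleMean h (1 - 1 / ((n : ℝ) + 2))) n)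
  · have hpos : 0 < 1 / ((n : ℝ) + 2) := by positivity
    have hlt : 1 / ((n : ℝ) + 2) < 1 := by
      rw [div_lt_one (by positivity)]; linarith [Nat.cast_nonneg (α := ℝ) n]
    exact le_iSup₂ (f := fun r (_ : r ∈ Set.Ioo (0 : ℝ) 1) => circleMean h r) _
      ⟨by linarith, by linarith⟩

theorem measurable_circleMean_slice {g : ℂ × ℂ → ℂ} (hg : Measurable g) (r s : ℝ) :
    Measurable fun θ => circleMean (fun w => g (w, polarPoint r θ)) s := by
  have hm : Measurable fun p : ℝ × ℝ => ‖g (polarPoint s p.2, polarPoint r p.1)‖ₑ ^ 2 :=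
    (hg.comp (f := fun p : ℝ × ℝ => (polarPoint s p.2, polarPoint r p.1))
      (((continuous_polarPoint s).measurable.comp measurable_snd).prodMk
        ((continuous_polarPoint r).measurable.comp measurable_fst))).enorm.pow_const 2
  exact hm.lintegral_prod_right'

theorem measurable_iSup_circleMean_slice {g : ℂ × ℂ → ℂ} (hg : DifferentiableOn ℂ g bidisc)
    (hgm : Measurable g) {r : ℝ} (hr : r ∈ Set.Ioo (0 : ℝ) 1) :
    Measurable fun θ =>
      ⨆ s ∈ Set.Ioo (0 : ℝ) 1, circleMean (fun w => g (w, polarPoint r θ)) s := by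
  simp only [fun θ => iSup_circleMean_eq
    (differentiableOn_slice₁ hg (polarPoint_mem_disc hr.1.le hr.2 θ))]
  exact Measurable.iSup fun n => measurable_circleMean_slice hgm r _

theorem lintegral_iSup_circleMean_slice_le {g : ℂ × ℂ → ℂ} (hg : DifferentiableOn ℂ g bidisc)
    (hgm : Measurable g) {r : ℝ} (hr : r ∈ Set.Ioo (0 : ℝ) 1) :
    ∫⁻ θ, ⨆ s ∈ Set.Ioo (0 : ℝ) 1, circleMean (fun w => g (w, polarPoint r θ)) s
      ∂angleMeasure ≤ hardyNormSq g := by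
  have hs : ∀ n : ℕ, 1 - 1 / ((n : ℝ) + 2) ∈ Set.Ioo (0 : ℝ) 1 := fun n => by
    have hpos : 0 < 1 / ((n : ℝ) + 2) := by positivity
    have hlt : 1 / ((n : ℝ) + 2) < 1 := by
      rw [div_lt_one (by positivity)]; linarith [Nat.cast_nonneg (α := ℝ) n]
    exact ⟨by linarith, by linarith⟩
  have hsl := fun θ => differentiableOn_slice₁ hg (polarPoint_mem_disc hr.1.le hr.2 θ)
  simp only [fun θ => iSup_circleMean_eq (hsl θ)]
  rw [lintegral_iSup (fun n => measurable_circleMean_slice hgm r _)]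
  · refine iSup_le fun n => ?_
    have := torusMean_swap hg ⟨(hs n).1.le, (hs n).2⟩ ⟨hr.1.le, hr.2⟩
    exact this.symm.le.trans (torusMean_le_hardyNormSq hg (hs n) hr)
  · intro n m hnm θ
    refine circleMean_mono (hsl θ) (hs n).1.le ?_ (hs m).2
    have : (n : ℝ) ≤ m := by exact_mod_cast hnm
    gcongr

theorem enorm_sq_le_of_eq_mul {δ : ℝ} (hδ : 0 < δ) {x y c : ℂ} (hc : δ ≤ ‖c‖) (h : x = c * y) :
    ‖y‖ₑ ^ 2 ≤ ENNReal.ofReal (δ⁻¹ ^ 2) * ‖x‖ₑ ^ 2 := by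
  rw [ENNReal.ofReal_pow (inv_nonneg.2 hδ.le), ← mul_pow]
  gcongr
  rw [← ofReal_norm, ← ofReal_norm, ← ENNReal.ofReal_mul (inv_nonneg.2 hδ.le)]
  refine ENNReal.ofReal_le_ofReal ?_
  rw [h, norm_mul, ← div_eq_inv_mul, le_div_iff₀ hδ, mul_comm]
  gcongr

/-! ### Division in the Dirichlet space of the bidisc. -/

/-- The part of the Dirichlet integral that involves `∂₂`, on the circle `|z₁| = r`. -/
def slicedDirichlet₂ (μ : Measure closedDisc) (f : ℂ × ℂ → ℂ) (r : ℝ) : ℝ≥0∞ :=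
  ∫⁻ θ, ∫⁻ z₂, ‖partial₂ f (polarPoint r θ) z₂‖ₑ ^ 2 * weight μ z₂ ∂areaMeasure ∂angleMeasure

/-- By Tonelli the angular integral becomes the inner one, and for fixed `z₂` it is a circle mean of
the holomorphic function `z₁ ↦ ∂₂ g`. -/
theorem slicedDirichlet₂_mono (μ : Measure closedDisc) [IsFiniteMeasure μ] {g : ℂ × ℂ → ℂ}
    (hg : DifferentiableOn ℂ g bidisc) (hgm : Measurable g) {r t : ℝ} (h0 : 0 ≤ r) (hrt : r ≤ t)
    (h1 : t < 1) : slicedDirichlet₂ μ g r ≤ slicedDirichlet₂ μ g t := by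
  have hwm := measurable_weight μ
  have : SFinite areaMeasure := by unfold areaMeasure; infer_instance
  have hswap : ∀ s ∈ Set.Ico (0 : ℝ) 1, slicedDirichlet₂ μ g s =
      ∫⁻ z₂, circleMean (fun z₁ => partial₂ g z₁ z₂) s * weight μ z₂ ∂areaMeasure := by
    intro s hs
    set P : ℂ × ℂ → ℂ := bidisc.indicator fun z => partial₂ g z.1 z.2 with hP
    have hPm : Measurable P := measurable_indicator_partial₂ hg hgm
    have hPeq : ∀ θ, ∀ z₂ ∈ disc, P (polarPoint s θ, z₂) = partial₂ g (polarPoint s θ) z₂ :=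
      fun θ z₂ hz => Set.indicator_of_mem (show (polarPoint s θ, z₂) ∈ bidisc from
        ⟨polarPoint_mem_disc hs.1 hs.2 θ, hz⟩) _
    have hm1 : Measurable fun p : ℝ × ℂ => P (polarPoint s p.1, p.2) :=
      hPm.comp (f := fun p : ℝ × ℂ => (polarPoint s p.1, p.2))
        (((continuous_polarPoint s).measurable.comp measurable_fst).prodMk measurable_snd)
    have hm2 : Measurable fun p : ℝ × ℂ => ‖P (polarPoint s p.1, p.2)‖ₑ ^ 2 * weight μ p.2 :=
      (hm1.enorm.pow_const 2).mul (hwm.comp measurable_snd)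
    calc slicedDirichlet₂ μ g s
        = ∫⁻ θ, ∫⁻ z₂, ‖P (polarPoint s θ, z₂)‖ₑ ^ 2 * weight μ z₂ ∂areaMeasure
            ∂angleMeasure := by
          refine lintegral_congr fun θ => lintegral_congr_ae ?_
          filter_upwards [ae_areaMeasure_mem_disc] with z hz
          rw [hPeq θ z hz]
      _ = ∫⁻ z₂, ∫⁻ θ, ‖P (polarPoint s θ, z₂)‖ₑ ^ 2 * weight μ z₂ ∂angleMeasure
            ∂areaMeasure := lintegral_lintegral_swap hm2.aemeasurable
      _ = _ := by
          refine lintegral_congr_ae ?_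
          filter_upwards [ae_areaMeasure_mem_disc] with z hz
          have hmz : Measurable fun θ => ‖P (polarPoint s θ, z)‖ₑ ^ 2 :=
            (hm1.comp (f := fun θ : ℝ => (θ, z)) (by fun_prop)).enorm.pow_const 2
          rw [lintegral_mul_const _ hmz]
          congr 1
          exact lintegral_congr fun θ => by rw [hPeq θ z hz]
  rw [hswap r ⟨h0, hrt.trans_lt h1⟩, hswap t ⟨h0.trans hrt, h1⟩]
  refine lintegral_mono_ae ?_
  filter_upwards [ae_areaMeasure_mem_disc] with z hz
  gcongr
  exact circleMean_mono (differentiableOn_partial₂ hg hz) h0 hrt h1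

theorem exists_mem_dirichletSpace_eq_sub_mul (μ₁ μ₂ : Measure closedDisc) [IsFiniteMeasure μ₁]
    [IsFiniteMeasure μ₂] {f : ℂ × ℂ → ℂ} (hf : f ∈ dirichletSpace μ₁ μ₂) {a : ℂ} (ha : a ∈ disc)
    (h0 : ∀ z₂ ∈ disc, f (a, z₂) = 0) :
    ∃ g ∈ dirichletSpace μ₁ μ₂, ∀ z ∈ bidisc, f z = (z.1 - a) * g z := by
  obtain ⟨⟨hfd, hfH⟩, hfD⟩ := hf
  obtain ⟨g, hg, hg0, hfg⟩ := exists_eq_sub_mul hfd ha h0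
  have hgm := measurable_of_differentiableOn hg hg0
  obtain ⟨C, hC, hdiv⟩ := exists_division_bound ha
  rw [mem_disc] at ha
  set ρ := (1 + ‖a‖) / 2 with hρdef
  have hρ : ρ ∈ Set.Ioo (0 : ℝ) 1 := by
    constructor <;> rw [hρdef] <;> linarith [norm_nonneg a]
  set δ := (1 - ‖a‖) / 2 with hδdef
  have hδ : 0 < δ := by rw [hδdef]; linarith
  -- Radii are enlarged to `max r ρ`, where the circle in `z₁` keeps distance at least `δ` from `a`.
  have hmax : ∀ r ∈ Set.Ioo (0 : ℝ) 1, max r ρ ∈ Set.Ioo (0 : ℝ) 1 := fun r hr =>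
    ⟨lt_max_of_lt_left hr.1, max_lt hr.2 hρ.2⟩
  have hlow : ∀ t, ρ ≤ t → ∀ θ, δ ≤ ‖polarPoint t θ - a‖ := fun t ht θ => by
    have h1 := norm_sub_norm_le (polarPoint t θ) a
    rw [norm_polarPoint, abs_of_pos (hρ.1.trans_le ht)] at h1
    linarith
  set K := ENNReal.ofReal (δ⁻¹ ^ 2) with hK
  have hKt : K ≠ ⊤ := ENNReal.ofReal_ne_top
  have hgH : hardyNormSq g < ⊤ := by
    refine lt_of_le_of_lt (iSup₂_le fun r hr => ?_) (ENNReal.mul_lt_top hKt.lt_top hfH)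
    have ht := hmax r hr
    set t := max r ρ with htdef
    have hrt : r ≤ t := le_max_left _ _
    calc torusMean g r r ≤ torusMean g r t :=
          torusMean_mono_right hg ⟨hr.1.le, hr.2⟩ hr.1.le hrt ht.2
      _ ≤ torusMean g t t := torusMean_mono_left hg ⟨ht.1.le, ht.2⟩ hr.1.le hrt ht.2
      _ ≤ ∫⁻ θ₁, ∫⁻ θ₂, K * ‖f (polarPoint t θ₁, polarPoint t θ₂)‖ₑ ^ 2
            ∂angleMeasure ∂angleMeasure := by
          refine lintegral_mono fun θ₁ => lintegral_mono fun θ₂ => ?_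
          exact enorm_sq_le_of_eq_mul hδ (hlow t (le_max_right _ _) θ₁)
            (hfg _ ⟨polarPoint_mem_disc ht.1.le ht.2 θ₁, polarPoint_mem_disc ht.1.le ht.2 θ₂⟩)
      _ = K * torusMean f t t := by
          simp only [lintegral_const_mul' _ _ hKt]
          rfl
      _ ≤ K * hardyNormSq f := by
          gcongr
          exact torusMean_le_hardyNormSq hfd ht ht
  obtain ⟨hf1, hf2⟩ := ENNReal.add_lt_top.1 hfD
  refine ⟨g, ⟨⟨hg, hgH⟩, ENNReal.add_lt_top.2 ⟨?_, ?_⟩⟩, hfg⟩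
  -- The `∂₁` part: the one-variable estimate on each slice, integrated over the angle; the Hardy
  -- norms of the slices integrate to at most that of `g`.
  · refine lt_of_le_of_lt (b := C * ((⨆ r ∈ Set.Ioo (0 : ℝ) 1, ∫⁻ θ, ∫⁻ z₁,
      ‖partial₁ f z₁ (polarPoint r θ)‖ₑ ^ 2 * weight μ₁ z₁ ∂areaMeasure ∂angleMeasure) +
        μ₁ Set.univ * hardyNormSq g)) (iSup₂_le fun r hr => ?_)
      (ENNReal.mul_lt_top hC.lt_top (ENNReal.add_lt_top.2
        ⟨hf1, ENNReal.mul_lt_top (measure_lt_top _ _) hgH⟩))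
    have hmem := fun θ => polarPoint_mem_disc hr.1.le hr.2 θ
    have hSm := measurable_iSup_circleMean_slice hg hgm hr
    calc _ ≤ ∫⁻ θ, C * (∫⁻ z₁, ‖partial₁ f z₁ (polarPoint r θ)‖ₑ ^ 2 * weight μ₁ z₁
            ∂areaMeasure + μ₁ Set.univ *
              ⨆ s ∈ Set.Ioo (0 : ℝ) 1, circleMean (fun w => g (w, polarPoint r θ)) s)
            ∂angleMeasure :=
          lintegral_mono fun θ => hdiv μ₁ (fun w => f (w, polarPoint r θ))
            (fun w => g (w, polarPoint r θ)) (differentiableOn_slice₁ hg (hmem θ))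
            fun z hz => hfg _ ⟨hz, hmem θ⟩
      _ = C * (∫⁻ θ, ∫⁻ z₁, ‖partial₁ f z₁ (polarPoint r θ)‖ₑ ^ 2 * weight μ₁ z₁
            ∂areaMeasure ∂angleMeasure + μ₁ Set.univ * ∫⁻ θ,
              ⨆ s ∈ Set.Ioo (0 : ℝ) 1, circleMean (fun w => g (w, polarPoint r θ)) s
            ∂angleMeasure) := by
          rw [lintegral_const_mul' _ _ hC, lintegral_add_right _ (hSm.const_mul _),
            lintegral_const_mul _ hSm]
      _ ≤ _ := by
          gcongr
          · exact le_iSup₂ (f := fun r (_ : r ∈ Set.Ioo (0 : ℝ) 1) => ∫⁻ θ, ∫⁻ z₁,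
              ‖partial₁ f z₁ (polarPoint r θ)‖ₑ ^ 2 * weight μ₁ z₁ ∂areaMeasure ∂angleMeasure) r hr
          · exact lintegral_iSup_circleMean_slice_le hg hgm hr
  -- The `∂₂` part: `z₁ - a` is constant for `∂₂`, so it factors out on the enlarged circle.
  · refine lt_of_le_of_lt (iSup₂_le fun r hr => ?_) (ENNReal.mul_lt_top hKt.lt_top hf2)
    have ht := hmax r hr
    set t := max r ρ with htdef
    have hmem := fun θ => polarPoint_mem_disc ht.1.le ht.2 θ
    calc slicedDirichlet₂ μ₂ g r ≤ slicedDirichlet₂ μ₂ g t :=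
          slicedDirichlet₂_mono μ₂ hg hgm hr.1.le (le_max_left _ _) ht.2
      _ ≤ ∫⁻ θ, ∫⁻ z₂, K * (‖partial₂ f (polarPoint t θ) z₂‖ₑ ^ 2 * weight μ₂ z₂)
            ∂areaMeasure ∂angleMeasure := by
          refine lintegral_mono fun θ => lintegral_mono_ae ?_
          filter_upwards [ae_areaMeasure_mem_disc] with z hz
          rw [← mul_assoc]
          gcongr
          refine enorm_sq_le_of_eq_mul hδ (hlow t (le_max_right _ _) θ) ?_
          have hev : (fun w => f (polarPoint t θ, w)) =ᶠ[𝓝 z]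
              fun w => (polarPoint t θ - a) * g (polarPoint t θ, w) :=
            eventually_of_mem (isOpen_disc.mem_nhds hz) fun w hw => hfg _ ⟨hmem θ, hw⟩
          rw [partial₂, hev.deriv_eq, deriv_const_mul _
            ((differentiableOn_slice₂ hg (hmem θ)).differentiableAt (isOpen_disc.mem_nhds hz))]
          rfl
      _ = K * slicedDirichlet₂ μ₂ f t := by
          simp only [lintegral_const_mul' _ _ hKt]
          rfl
      _ ≤ _ := by
          gcongr
          exact le_iSup₂ (f := fun r (_ : r ∈ Set.Ioo (0 : ℝ) 1) => slicedDirichlet₂ μ₂ f r) t ht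

theorem comp_swap_mem_dirichletSpace {μ₁ μ₂ : Measure closedDisc} {f : ℂ × ℂ → ℂ}
    (hf : f ∈ dirichletSpace μ₁ μ₂) : (fun z => f (z.2, z.1)) ∈ dirichletSpace μ₂ μ₁ := by
  obtain ⟨⟨hfd, hfH⟩, hfD⟩ := hf
  refine ⟨⟨differentiableOn_comp_swap hfd, lt_of_le_of_lt (iSup₂_le fun r hr => ?_) hfH⟩, ?_⟩
  · have hr' : r ∈ Set.Ico (0 : ℝ) 1 := ⟨hr.1.le, hr.2⟩
    exact (torusMean_swap hfd hr' hr').symm.le.trans (torusMean_le_hardyNormSq hfd hr hr)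
  -- The swap exchanges the two suprema by definition, so only their order in the sum changes.
  · rw [dirichletIntegral, add_comm] at hfD
    exact hfD

end DirichletBidisc

end

theorem mainTheorem8
    (μ₁ μ₂ : MeasureTheory.Measure DirichletBidisc.closedDisc)
    [MeasureTheory.IsFiniteMeasure μ₁] [MeasureTheory.IsFiniteMeasure μ₂] :
    DirichletBidisc.HasDivisionProperty (DirichletBidisc.dirichletSpace μ₁ μ₂) := by
  refine ⟨fun f hf a ha h0 =>
    DirichletBidisc.exists_mem_dirichletSpace_eq_sub_mul μ₁ μ₂ hf ha h0, fun f hf a ha h0 => ?_⟩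
  obtain ⟨g, hg, hfg⟩ := DirichletBidisc.exists_mem_dirichletSpace_eq_sub_mul μ₂ μ₁
    (DirichletBidisc.comp_swap_mem_dirichletSpace hf) ha h0
  exact ⟨fun z => g (z.2, z.1), DirichletBidisc.comp_swap_mem_dirichletSpace hg,
    fun z hz => hfg (z.2, z.1) ⟨hz.2, hz.1⟩⟩
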